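/- Let $n$ be a positive integer and consider the $n^2$ colours $a_ib_k$ with $0\le i,k\le n-1$. A colour $a_ib_k$ is called free if $i=k$ and bound if $i\ne k$. With $\chi(P)=1$ if $P$ is true and $0$ otherwise, put $$\Delta(a_ib_k,a_{i'}b_{k'})=\chi(i\ge i')-\chi(i=k=i')+\chi(k\le k')-\chi(k=i'=k').$$ Let $\mathcal P_n$ be the set of partitions $\lambda=\lambda_1+\cdots+\lambda_s$ ($s\ge 0$) into positive parts, each part $\lambda_j$ having a colour $c(\lambda_j)\in\{a_ib_k:0\le i,k\le n-1\}$, such that $\lambda_j-\lambda_{j+1}\ge\Delta(c(\lambda_j),c(\lambda_{j+1}))$ for all $1\le j\le s-1$. Its weight is $|\lambda|=\lambda_1+\cdots+\lambda_s$ and its colour sequence is $c(\lambda_1),\dots,c(\lambda_s)$. Let $\mathcal F_n$ be the set of $n^2$-coloured Frobenius partitions, i.e. of arrays $F=\begin{pmatrix}\lambda_1&\cdots&\lambda_s\\ \mu_1&\cdots&\mu_s\end{pmatrix}$ ($s\ge 0$) where $\lambda_1,\dots,\lambda_s$ are distinct non-negative integers each coloured with some $a_i$ ($0\le i\le n-1$),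 listed in decreasing order for $$0_{a_{n-1}}<\cdots<0_{a_0}<1_{a_{n-1}}<\cdots<1_{a_0}<\cdots,$$ and $\mu_1,\dots,\mu_s$ are distinct non-negative integers each coloured with some $b_i$ ($0\le i\le n-1$), listed in decreasing order for $$0_{b_0}<\cdots<0_{b_{n-1}}<1_{b_0}<\cdots<1_{b_{n-1}}<\cdots$$ (distinct means distinct as coloured integers: a given size may occur in several colours). Its weight is $|F|=s+\sum_i\lambda_i+\sum_i\mu_i$ and its colour sequence is $c(\lambda_1)c(\mu_1),\dots,c(\lambda_s)c(\mu_s)$. The reduction of a colour sequence is obtained by performing the following removals as long as possible (the order does not matter): from two consecutive colours $a_kb_\ell,a_\ell b_\ell$ remove the second one; from two consecutive colours $a_kb_k,a_kb_\ell$ remove the first one. A colour sequence is reduced if it equals its reduction. The kernel $\ker(\cdot)$ of an element of $\mathcal P_n$ or $\mathcal F_n$ is the reduction of its colour sequence. For every $m\ge 0$, $\mathcal P_n$ and $\mathcal F_n$ have finitely many elements of weight $m$, and the following hold. 1. For all non-negative integers $m,u_0,\dots,u_{n-1},v_0,\dots,v_{n-1}$, the number of $\lambda\in\mathcal P_n$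 of weight $m$ such that, for every $i\in\{0,\dots,n-1\}$, the symbol $a_i$ (resp. $b_i$) appears $u_i$ (resp. $v_i$) times in the bound colours of the colour sequence of $\lambda$ equals the number of $F\in\mathcal F_n$ of weight $m$ such that, for every $i\in\{0,\dots,n-1\}$, the symbol $a_i$ (resp. $b_i$) appears $u_i$ (resp. $v_i$) times in the bound colours of the colour sequence of $F$. 2. For every reduced colour sequence $S$ of colours $a_ib_k$, $0\le i,k\le n-1$, as formal power series in $q$, $$\sum_{\lambda\in\mathcal P_n,\ \ker(\lambda)=S}q^{|\lambda|}=\sum_{F\in\mathcal F_n,\ \ker(F)=S}q^{|F|}.$$ -/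

import Mathlib

namespace Primc

/-- A colour `a_i b_k` with `0 ≤ i, k ≤ n - 1`, encoded as the pair `(i, k)`. -/
abbrev Colour (n : ℕ) : Type := Fin n × Fin n

/-- Free colours are the `a_i b_i`. -/
def Colour.IsFree {n : ℕ} (c : Colour n) : Prop := c.1 = c.2

/-- Bound colours are the `a_i b_k` with `i ≠ k`. -/
def Colour.IsBound {n : ℕ} (c : Colour n) : Prop := c.1 ≠ c.2

instance {n : ℕ} (c : Colour n) : Decidable c.IsFree :=
  inferInstanceAs (Decidable (c.1 = c.2))

instance {n : ℕ} (c : Colour n) : Decidable c.IsBound :=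
  inferInstanceAs (Decidable (c.1 ≠ c.2))

/-- The indicator `χ(p)` of a proposition. -/
def chi (p : Prop) [Decidable p] : ℤ := if p then 1 else 0

/-- The minimal difference
`Δ(a_i b_k, a_{i'} b_{k'}) = χ(i ≥ i') - χ(i = k = i') + χ(k ≤ k') - χ(k = i' = k')`. -/
def Delta {n : ℕ} (c d : Colour n) : ℤ :=
  chi (c.1 ≥ d.1) - chi (c.1 = c.2 ∧ c.2 = d.1)
    + chi (c.2 ≤ d.2) - chi (c.2 = d.1 ∧ d.1 = d.2)

/-- A coloured partition `λ_1 + ⋯ + λ_s`: a weakly decreasing finite sequence of positive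
integers (the parts), each carrying a colour. -/
@[ext]
structure ColouredPartition (n : ℕ) where
  parts : List (ℕ × Colour n)
  pos : ∀ p ∈ parts, 0 < p.1
  sorted : parts.IsChain (fun p q => p.1 ≥ q.1)

namespace ColouredPartition

/-- The sum of the parts. -/
def weight {n : ℕ} (l : ColouredPartition n) : ℕ := (l.parts.map Prod.fst).sum

/-- The colour sequence `c(λ_1), …, c(λ_s)`. -/
def colours {n : ℕ} (l : ColouredPartition n) : List (Colour n) := l.parts.map Prod.snd

end ColouredPartition

/-- The generalised Primc partitions `𝒫_n`: those coloured partitions with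
`λ_j - λ_{j+1} ≥ Δ(c(λ_j), c(λ_{j+1}))` for all consecutive parts. (These conditions also
determine in which order equal parts of different colours are written, so that no partition
is counted twice.) -/
def PrimcPartitions (n : ℕ) : Set (ColouredPartition n) :=
  {l | l.parts.IsChain (fun p q => (p.1 : ℤ) - (q.1 : ℤ) ≥ Delta p.2 q.2)}

/-- `p_{a_i} > q_{a_j}` in the order
`0_{a_{n-1}} < ⋯ < 0_{a_0} < 1_{a_{n-1}} < ⋯ < 1_{a_0} < ⋯`. -/
def TopGT {n : ℕ} (x y : ℕ × Fin n) : Prop := y.1 < x.1 ∨ (y.1 = x.1 ∧ x.2 < y.2)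

/-- `p_{b_i} > q_{b_j}` in the order
`0_{b_0} < ⋯ < 0_{b_{n-1}} < 1_{b_0} < ⋯ < 1_{b_{n-1}} < ⋯`. -/
def BottomGT {n : ℕ} (x y : ℕ × Fin n) : Prop := y.1 < x.1 ∨ (y.1 = x.1 ∧ y.2 < x.2)

/-- An `n²`-coloured Frobenius partition: two rows `λ`, `μ` of the same length `s`, consisting
of distinct coloured non-negative parts (in decreasing order), the parts of `λ` being coloured by
`a_0, …, a_{n-1}` and those of `μ` by `b_0, …, b_{n-1}`. -/
@[ext]
structure FrobeniusPartition (n : ℕ) where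
  top : List (ℕ × Fin n)
  bottom : List (ℕ × Fin n)
  length_eq : top.length = bottom.length
  top_sorted : top.IsChain TopGT
  bottom_sorted : bottom.IsChain BottomGT

namespace FrobeniusPartition

/-- The weight `s + ∑ λ_i + ∑ μ_i`. -/
def weight {n : ℕ} (F : FrobeniusPartition n) : ℕ :=
  F.top.length + (F.top.map Prod.fst).sum + (F.bottom.map Prod.fst).sum

/-- The colour sequence `c(λ_1)c(μ_1), …, c(λ_s)c(μ_s)`. -/
def colours {n : ℕ} (F : FrobeniusPartition n) : List (Colour n) :=
  List.zipWith (fun x y => (x.2, y.2)) F.top F.bottom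

end FrobeniusPartition

/-- The number of times the symbol `a_i` appears in the bound colours of the sequence. -/
def boundCountA {n : ℕ} (C : List (Colour n)) (i : Fin n) : ℕ :=
  C.countP (fun c => c.IsBound ∧ c.1 = i)

/-- The number of times the symbol `b_i` appears in the bound colours of the sequence. -/
def boundCountB {n : ℕ} (C : List (Colour n)) (i : Fin n) : ℕ :=
  C.countP (fun c => c.IsBound ∧ c.2 = i)

/-- One removal in a colour sequence: from `a_k b_l, a_l b_l` remove the second colour, or from
`a_k b_k, a_k b_l` remove the first one. -/
inductive Removal {n : ℕ} : List (Colour n) → List (Colour n) → Prop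
  | right (X Y : List (Colour n)) (k l : Fin n) :
      Removal (X ++ (k, l) :: (l, l) :: Y) (X ++ (k, l) :: Y)
  | left (X Y : List (Colour n)) (k l : Fin n) :
      Removal (X ++ (k, k) :: (k, l) :: Y) (X ++ (k, l) :: Y)

/-- Put a colour in front of a reduced colour sequence and reduce again. -/
def reduceCons {n : ℕ} (c : Colour n) : List (Colour n) → List (Colour n)
  | [] => [c]
  | d :: R =>
    if c.1 = c.2 ∧ c.2 = d.1 then d :: R
    else if c.2 = d.1 ∧ d.1 = d.2 then c :: R
    else c :: d :: R

/-- The reduction of a colour sequence: the result of performing removals as long as possible.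
The lemmas `removals_reduce`, `not_removal_reduce` and `eq_reduce` below show that this is what
the function computes, whatever the order of the removals. -/
def reduce {n : ℕ} : List (Colour n) → List (Colour n)
  | [] => []
  | c :: C => reduceCons c (reduce C)

/-- A colour sequence is reduced if it is equal to its reduction. -/
def IsReduced {n : ℕ} (S : List (Colour n)) : Prop := reduce S = S

theorem Removal.cons {n : ℕ} {C D : List (Colour n)} (c : Colour n) (h : Removal C D) :
    Removal (c :: C) (c :: D) := by
  cases h with
  | right X Y k l => exact Removal.right (c :: X) Y k l
  | left X Y k l => exact Removal.left (c :: X) Y k l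

/-- The reduction of `C` is obtained from `C` by removals. -/
theorem removals_reduce {n : ℕ} (C : List (Colour n)) :
    Relation.ReflTransGen Removal C (reduce C) := by
  induction C with
  | nil => exact Relation.ReflTransGen.refl
  | cons c C ih =>
    have h1 : Relation.ReflTransGen Removal (c :: C) (c :: reduce C) :=
      ih.lift (fun l => c :: l) (fun _ _ h => Removal.cons c h)
    refine h1.trans ?_
    show Relation.ReflTransGen Removal (c :: reduce C) (reduceCons c (reduce C))
    generalize reduce C = R
    obtain ⟨k, l⟩ := c
    cases R with
    | nil => exact Relation.ReflTransGen.refl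
    | cons d R =>
      obtain ⟨i, j⟩ := d
      simp only [reduceCons]
      split_ifs with h h'
      · obtain ⟨rfl, rfl⟩ := h
        exact Relation.ReflTransGen.single (Removal.left [] R _ _)
      · obtain ⟨rfl, rfl⟩ := h'
        exact Relation.ReflTransGen.single (Removal.right [] R _ _)
      · exact Relation.ReflTransGen.refl

/-- No removal changes the reduction. -/
theorem reduce_eq_of_removal {n : ℕ} {C D : List (Colour n)} (h : Removal C D) :
    reduce C = reduce D := by
  cases h with
  | right X Y k l =>
    induction X with
    | nil =>
      show reduceCons _ (reduceCons _ (reduce Y)) = reduceCons _ (reduce Y)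
      generalize reduce Y = R
      cases R with
      | nil => simp only [reduceCons]; grind
      | cons d R => obtain ⟨i, j⟩ := d; simp only [reduceCons]; grind [reduceCons]
    | cons c X ih => exact congrArg (reduceCons c) ih
  | left X Y k l =>
    induction X with
    | nil =>
      show reduceCons _ (reduceCons _ (reduce Y)) = reduceCons _ (reduce Y)
      generalize reduce Y = R
      cases R with
      | nil => simp only [reduceCons]; grind
      | cons d R => obtain ⟨i, j⟩ := d; simp only [reduceCons]; grind [reduceCons]
    | cons c X ih => exact congrArg (reduceCons c) ih

theorem removal_length {n : ℕ} {C D : List (Colour n)} (h : Removal C D) :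
    D.length < C.length := by
  cases h <;> simp

theorem length_reduceCons {n : ℕ} (c : Colour n) (R : List (Colour n)) :
    (reduceCons c R).length ≤ R.length + 1 := by
  cases R with
  | nil => simp [reduceCons]
  | cons d R => simp only [reduceCons]; split_ifs <;> simp

theorem length_reduce {n : ℕ} (C : List (Colour n)) : (reduce C).length ≤ C.length := by
  induction C with
  | nil => simp [reduce]
  | cons c C ih =>
    have := length_reduceCons c (reduce C)
    simp only [reduce, List.length_cons]
    omega

theorem reduce_eq_of_removals {n : ℕ} {C D : List (Colour n)}
    (h : Relation.ReflTransGen Removal C D) : reduce C = reduce D := by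
  induction h with
  | refl => rfl
  | tail _ h ih => exact ih.trans (reduce_eq_of_removal h)

/-- No removal is possible in the reduction of `C`. -/
theorem not_removal_reduce {n : ℕ} (C D : List (Colour n)) : ¬ Removal (reduce C) D := by
  intro h
  have h1 := reduce_eq_of_removals (removals_reduce C)
  have h2 := reduce_eq_of_removal h
  have h3 := length_reduce D
  have h4 := removal_length h
  rw [← h2, ← h1] at h3
  omega

/-- Every sequence obtained from `C` by removals as long as possible, in whatever order, is the
reduction of `C`. -/
theorem eq_reduce {n : ℕ} {C D : List (Colour n)} (h : Relation.ReflTransGen Removal C D)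
    (hD : ∀ E, ¬ Removal D E) : D = reduce C := by
  rw [reduce_eq_of_removals h]
  rcases Relation.ReflTransGen.cases_head (removals_reduce D) with h' | ⟨E, hE, _⟩
  · exact h'
  · exact absurd hE (hD E)

/-- The kernel of a coloured partition: the reduction of its colour sequence. -/
def ColouredPartition.ker {n : ℕ} (l : ColouredPartition n) : List (Colour n) :=
  reduce l.colours

/-- The kernel of a coloured Frobenius partition: the reduction of its colour sequence. -/
def FrobeniusPartition.ker {n : ℕ} (F : FrobeniusPartition n) : List (Colour n) :=
  reduce F.colours

/-- The number of partitions of `m` in `𝒫_n` in whose bound colours, for every `i`, the symbol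
`a_i` appears `u i` times and the symbol `b_i` appears `v i` times. -/
noncomputable def boundPrimcCount (n m : ℕ) (u v : Fin n → ℕ) : ℕ :=
  Set.ncard {l : ColouredPartition n | l ∈ PrimcPartitions n ∧ l.weight = m ∧
    (∀ i, boundCountA l.colours i = u i) ∧ (∀ i, boundCountB l.colours i = v i)}

/-- The number of `n²`-coloured Frobenius partitions of `m` in whose bound colours, for every `i`,
the symbol `a_i` appears `u i` times and the symbol `b_i` appears `v i` times. -/
noncomputable def boundFrobeniusCount (n m : ℕ) (u v : Fin n → ℕ) : ℕ :=
  Set.ncard {F : FrobeniusPartition n | F.weight = m ∧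
    (∀ i, boundCountA F.colours i = u i) ∧ (∀ i, boundCountB F.colours i = v i)}

/-- The generating function `∑_{x ∈ A} q^{|x|}` as a formal power series in `q`, for a set `A`
that has finitely many elements of each weight. -/
noncomputable def weightSeries {α : Type} (A : Set α) (w : α → ℕ) : PowerSeries ℤ :=
  PowerSeries.mk (fun m => (Set.ncard {x | x ∈ A ∧ w x = m} : ℤ))

end Primc

namespace Primc

open PowerSeries Finset

/-! Everything is proved for one kernel at a time. The count by symbols in bound colours follows,
because removals delete only free colours, so these numbers depend on the kernel alone.

For a fixed colour word the generating function is a product: appending a smaller part to s parts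
contributes a power of q given by the minimal difference, and a factor 1/(1-q^s) for the excess. In
a Frobenius partition the two rows are independent once the colours are fixed, so their minimal
differences add and the factor is squared. The words with given kernel and last colour are collected
in a series in z marking length. The kernel can be computed letter by letter, and multiplying the
coefficient of z^s by 1-q^s is the operator f(z) ↦ f(z) - f(qz). Hence deleting the last letter
yields q-difference equations (`diff_state`), of first order for 𝒫_n and of second order for ℱ_n.

The two systems are linked by the transform `trans`, z^m ↦ z^m (qz;q)_∞/(q;q)_m. By the intertwining
rules `trans_diff` and `shift_trans_diff`, transforms of first order solutions solve the second
order equations, whose solution is determined by its constant term (`eq_of_second_order`). Induction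
on the kernel (`related_of_rreduced`) gives the invariant `Related`, and `flow_trans` then expresses
the ℱ_n series as `diff` of the transform of the 𝒫_n series. This `diff` cancels one of the two
factors 1/(1-q^s) left at the end, and `sum_trans`, a partial fraction identity, shows that the sum
of the coefficients divided by 1-q^s is unchanged by the transform. -/

/-- The inverse of `1 - q ^ m` in `ℤ⟦q⟧`, for `m ≠ 0`. -/
noncomputable def invOneSub (m : ℕ) : PowerSeries ℤ := invOfUnit (1 - X ^ m) 1

theorem one_sub_mul_invOneSub {m : ℕ} (hm : m ≠ 0) :
    (1 - X ^ m) * invOneSub m = (1 : PowerSeries ℤ) :=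
  mul_invOfUnit _ _ (by simp [hm])

/-- The inverse of `(q; q)_m`. -/
noncomputable def invPoch (m : ℕ) : PowerSeries ℤ := ∏ i ∈ range m, invOneSub (i + 1)

theorem invPoch_zero : invPoch 0 = 1 := by simp [invPoch]

theorem one_sub_mul_invPoch (m : ℕ) :
    (1 - X ^ (m + 1)) * invPoch (m + 1) = invPoch m := by
  rw [invPoch, prod_range_succ, mul_left_comm, one_sub_mul_invOneSub (Nat.succ_ne_zero m), mul_one,
    invPoch]

theorem one_sub_X_pow_ne_zero {m : ℕ} (hm : m ≠ 0) : (1 - X ^ m : PowerSeries ℤ) ≠ 0 := by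
  intro h
  have := one_sub_mul_invOneSub hm
  rw [h, zero_mul] at this
  exact zero_ne_one this

/-! ### Series in z over ℤ⟦q⟧ and q-difference operators -/

/-- Formal power series in `z` with coefficients in `ℤ⟦q⟧`. -/
abbrev ZSeries : Type := PowerSeries (PowerSeries ℤ)

/-- The substitution `z ↦ q ^ e z`. -/
noncomputable def shift (e : ℕ) : ZSeries →+* ZSeries := rescale (X ^ e)

theorem coeff_shift (e s : ℕ) (x : ZSeries) : coeff s (shift e x) = X ^ (e * s) * coeff s x := by
  rw [shift, coeff_rescale, ← pow_mul]

theorem shift_zero (x : ZSeries) : shift 0 x = x := by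
  ext1 s; simp [coeff_shift]

theorem shift_shift (a b : ℕ) (x : ZSeries) : shift a (shift b x) = shift (a + b) x := by
  ext1 s
  rw [coeff_shift, coeff_shift, coeff_shift, ← mul_assoc, ← pow_add, add_mul]

theorem shift_injective (e : ℕ) : Function.Injective (shift e) := by
  intro x y h
  ext1 s
  have := congrArg (coeff s) h
  rw [coeff_shift, coeff_shift] at this
  exact mul_left_cancel₀ (pow_ne_zero _ X_ne_zero) this

/-- The difference operator `f(z) ↦ f(z) - f(q z)`. -/
noncomputable def diff (x : ZSeries) : ZSeries := x - shift 1 x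

theorem coeff_diff (s : ℕ) (x : ZSeries) : coeff s (diff x) = (1 - X ^ s) * coeff s x := by
  rw [diff, map_sub, coeff_shift]; ring

theorem diff_add (x y : ZSeries) : diff (x + y) = diff x + diff y := by
  simp only [diff, map_add]; ring

theorem diff_sub (x y : ZSeries) : diff (x - y) = diff x - diff y := by
  simp only [diff, map_sub]; ring

theorem diff_shift (e : ℕ) (x : ZSeries) : diff (shift e x) = shift e (diff x) := by
  simp only [diff, map_sub, shift_shift, add_comm]

theorem diff_cancel {x y : ZSeries} (h : diff x = diff y)
    (h0 : coeff 0 x = coeff 0 y) : x = y := by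
  ext1 s
  rcases eq_or_ne s 0 with rfl | hs
  · exact h0
  · have := congrArg (coeff s) h
    rw [coeff_diff, coeff_diff] at this
    exact mul_left_cancel₀ (one_sub_X_pow_ne_zero hs) this

theorem coeff_zero_diff (x : ZSeries) : coeff 0 (diff x) = 0 := by
  rw [coeff_diff]; simp

theorem diff_diff_cancel {x y : ZSeries} (h : diff (diff x) = diff (diff y))
    (h0 : coeff 0 x = coeff 0 y) : x = y :=
  diff_cancel (diff_cancel h (by rw [coeff_zero_diff, coeff_zero_diff])) h0

/-! ### The transform z^m ↦ z^m (qz;q)_∞/(q;q)_m and its intertwining rules -/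

/-- The diagonal operator `z ^ m ↦ z ^ m / (q; q)_m`. -/
noncomputable def borel (x : ZSeries) : ZSeries := mk fun m => invPoch m * coeff m x

theorem coeff_borel (m : ℕ) (x : ZSeries) : coeff m (borel x) = invPoch m * coeff m x :=
  coeff_mk _ _

theorem borel_shift (e : ℕ) (x : ZSeries) : borel (shift e x) = shift e (borel x) := by
  ext1 s; simp only [coeff_borel, coeff_shift]; ring

theorem borel_add (x y : ZSeries) : borel (x + y) = borel x + borel y := by
  ext1 s; simp only [coeff_borel, map_add]; ring

theorem borel_sub (x y : ZSeries) : borel (x - y) = borel x - borel y := by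
  ext1 s; simp only [coeff_borel, map_sub]; ring

/-- The denominator of index m+1 has one more factor 1-q^(m+1), which `diff` cancels; so z passes
through `borel` at the price of one `diff`. -/
theorem X_mul_borel (x : ZSeries) : X * borel x = borel (diff (X * x)) := by
  ext1 s
  rw [coeff_borel, coeff_diff]
  cases s with
  | zero => simp
  | succ s =>
    rw [coeff_succ_X_mul, coeff_succ_X_mul, coeff_borel, ← one_sub_mul_invPoch s]; ring

/-- The coefficients of `(q z; q)_∞`. -/
noncomputable def eulerCoeff (j : ℕ) : PowerSeries ℤ :=
  (-1) ^ j * X ^ (∑ i ∈ range (j + 1), i) * invPoch j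

theorem eulerCoeff_succ (j : ℕ) :
    (1 - X ^ (j + 1)) * eulerCoeff (j + 1) = - (X ^ (j + 1) * eulerCoeff j) := by
  rw [eulerCoeff, eulerCoeff, sum_range_succ _ (j + 1), ← one_sub_mul_invPoch j, pow_add]; ring

/-- The series `(q z; q)_∞`. -/
noncomputable def eulerSeries : ZSeries := mk eulerCoeff

theorem shift_X (e : ℕ) : shift e (X : ZSeries) = C (X ^ e) * X := by
  ext1 s
  rw [coeff_shift, coeff_C_mul, coeff_X]
  split_ifs with h
  · simp [h]
  · simp

theorem eulerSeries_eq : eulerSeries = (1 - shift 1 X) * shift 1 eulerSeries := by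
  ext1 s
  rw [shift_X, sub_mul, one_mul, map_sub, mul_assoc, coeff_C_mul]
  cases s with
  | zero => simp [coeff_shift]
  | succ s =>
    rw [coeff_succ_X_mul, coeff_shift, coeff_shift, eulerSeries, coeff_mk, coeff_mk]
    linear_combination eulerCoeff_succ s

/-- The operator that relates the two sides of the identity. -/
noncomputable def trans (x : ZSeries) : ZSeries := borel x * eulerSeries

theorem trans_add (x y : ZSeries) : trans (x + y) = trans x + trans y := by
  rw [trans, borel_add, add_mul, trans, trans]

theorem trans_sub (x y : ZSeries) : trans (x - y) = trans x - trans y := by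
  rw [trans, borel_sub, sub_mul, trans, trans]

theorem X_mul_trans (x : ZSeries) : X * trans x = trans (diff (X * x)) := by
  rw [trans, trans, ← mul_assoc, X_mul_borel]

theorem coeff_zero_trans (x : ZSeries) : coeff 0 (trans x) = coeff 0 x := by
  rw [trans, coeff_mul]
  simp [coeff_borel, eulerSeries, eulerCoeff, invPoch]

/-- `borel` is diagonal and commutes with z ↦ qz; the correction term comes from the factor 1-qz of
(qz;q)_∞. -/
theorem trans_diff (x : ZSeries) :
    trans (diff x) = diff (trans x) + shift 1 (X * trans x) := by
  simp only [trans, diff, borel_sub, borel_shift, map_mul]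
  linear_combination (-(shift 1 (borel x))) * eulerSeries_eq

/-- By `X_mul_borel` the factor 1-z comes out of `borel`, up to a shifted term; after z ↦ qz it
completes (q²z;q)_∞ to (qz;q)_∞. -/
theorem shift_trans_diff (x : ZSeries) :
    shift 1 (trans (diff ((1 - X) * x))) = diff (trans (shift 1 x)) := by
  have h : shift 1 (borel (diff ((1 - X) * x))) =
      (1 - shift 1 X) * borel (shift 1 x) - shift 1 (borel (shift 1 x)) := by
    have h1 : (1 - X) * x = x - X * x := by ring
    rw [h1, diff_sub, borel_sub, ← X_mul_borel, diff, borel_sub, borel_shift]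
    simp only [map_sub, map_mul]; ring
  rw [trans, map_mul, h, diff, trans, map_mul]
  linear_combination (-(borel (shift 1 x))) * eulerSeries_eq

theorem shift_X_mul_trans (x : ZSeries) :
    shift 1 (X * trans ((1 - X) * x)) = diff (trans (shift 1 (X * x))) := by
  rw [X_mul_trans, ← shift_trans_diff]
  have h : X * ((1 - X) * x) = (1 - X) * (X * x) := by ring
  rw [h]

/-! ### Transforming solutions of the q-difference equations -/

/-- A solution of the homogeneous second order equation without constant term vanishes. -/
theorem eq_of_second_order {x y w : ZSeries}
    (hx : diff (diff x) = w + shift 2 (X * x)) (hy : diff (diff y) = w + shift 2 (X * y))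
    (h0 : coeff 0 x = coeff 0 y) : x = y := by
  ext1 s
  induction s with
  | zero => exact h0
  | succ s ih =>
    have h1 := congrArg (coeff (s + 1)) hx
    have h2 := congrArg (coeff (s + 1)) hy
    rw [coeff_diff, coeff_diff, map_add, coeff_shift, coeff_succ_X_mul] at h1 h2
    rw [ih, ← h2] at h1
    exact mul_left_cancel₀ (one_sub_X_pow_ne_zero (Nat.succ_ne_zero s))
      (mul_left_cancel₀ (one_sub_X_pow_ne_zero (Nat.succ_ne_zero s)) h1)

/-- For a kernel ending in a free colour: g and H are the series of 𝒫_n and ℱ_n, and Y collects the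
words to which this colour is newly appended. The proof checks that the transform of (1-z)g solves
the equation of H. -/
theorem free_step {g H Y : ZSeries} (hg : diff g = X * g + Y)
    (hH : diff (diff H) = diff (trans Y) + shift 2 (X * H)) (h0 : coeff 0 H = coeff 0 g) :
    H = trans ((1 - X) * g) := by
  refine eq_of_second_order hH ?_ ?_
  · have hY : Y = diff ((1 - X) * g) - shift 1 (X * g) := by
      rw [eq_comm, ← sub_eq_iff_eq_add'.2 hg]
      simp only [diff, map_sub, map_mul, sub_mul, one_mul]; ring
    have h1 := shift_X_mul_trans g
    rw [hY, trans_sub, diff_sub, trans_diff, diff_add, ← h1]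
    simp only [diff, map_sub, shift_shift]; ring
  · rw [h0, coeff_zero_trans]; simp

theorem bound_step {g H x : ZSeries} (hg : diff g = X * x + X * g)
    (hH : diff (diff H) = shift 1 (X * trans x) + shift 2 (X * H)) (hg0 : coeff 0 g = 0)
    (hH0 : coeff 0 H = 0) : H = trans (shift 1 g) := by
  refine eq_of_second_order hH ?_ ?_
  · have h1 : X * x = diff g - X * g := by rw [hg]; ring
    have h2 := trans_diff (shift 1 g)
    have h3 := shift_trans_diff (diff g)
    rw [← diff_shift, h2, diff_add] at h3
    have h4 : diff ((1 - X) * diff g) = diff (X * x) + diff (X * shift 1 g) := by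
      rw [h1, ← diff_add]; congr 1; simp only [diff]; ring
    rw [h4, trans_add, ← X_mul_trans, ← X_mul_trans, map_add] at h3
    have h5 : diff (shift 1 (X * trans (shift 1 g))) =
      shift 1 (X * trans (shift 1 g)) - shift 2 (X * trans (shift 1 g)) := by
      simp only [diff, shift_shift]
    rw [h5] at h3
    linear_combination -h3
  · rw [hH0, coeff_zero_trans, coeff_shift, hg0, mul_zero]

theorem shift_one_X_mul (x : ZSeries) : shift 1 (X * x) = X * (C X * shift 1 x) := by
  rw [map_mul, shift_X, pow_one]; ring

theorem trans_C_mul (a : PowerSeries ℤ) (x : ZSeries) : trans (C a * x) = C a * trans x := by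
  have : borel (C a * x) = C a * borel x := by
    ext1 s; rw [coeff_borel, coeff_C_mul, coeff_C_mul, coeff_borel]; ring
  rw [trans, this, trans, mul_assoc]

/-- For a kernel ending in a bound colour a_i b_k: e = χ(i>k) and e' = χ(i<k), so exactly one of
them is 1. The series p, r of words ending in a_i b_k itself are known up to a substitution z ↦ qz;
either value of e leads back to `bound_step`. -/
theorem bound_step' {e e' : ℕ} (he : e + e' = 1) {g H p r x : ZSeries}
    (hg : diff g = shift e (X * p) + X * g)
    (hH : diff (diff H) = shift (e + 1) (X * r) + shift 2 (X * H))
    (hp : shift 1 p = shift e' x) (hr : shift 1 r = shift e' (trans x))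
    (hg0 : coeff 0 g = 0) (hH0 : coeff 0 H = 0) : H = trans (shift 1 g) := by
  obtain ⟨rfl, rfl⟩ | ⟨rfl, rfl⟩ : e = 0 ∧ e' = 1 ∨ e = 1 ∧ e' = 0 := by omega
  · rw [shift_injective 1 hp, shift_zero] at hg
    rw [shift_injective 1 hr] at hH
    exact bound_step hg hH hg0 hH0
  · rw [shift_zero] at hp hr
    rw [shift_one_X_mul, hp] at hg
    rw [← shift_shift, shift_one_X_mul, hr, ← trans_C_mul] at hH
    exact bound_step hg hH hg0 hH0

/-- The equation of g rewrites the 𝒫_n side as `diff` of (1-z)g when α = e and of g(qz) when α =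
e+1; a different intertwining rule handles each. -/
theorem flow_bound {e α : ℕ} (hα : α = e ∨ α = e + 1) {g H p r : ZSeries}
    (hg : diff g = shift e (X * p) + X * g)
    (hH : diff (diff H) = shift (e + 1) (X * r) + shift 2 (X * H))
    (h : H = trans (shift 1 g)) :
    shift α (X * r) + shift 1 (X * H) =
      diff (trans (shift α (X * p) + shift 1 (X * g))) := by
  rcases hα with rfl | rfl
  · apply shift_injective 1
    have h1 : shift α (X * p) + shift 1 (X * g) = diff ((1 - X) * g) := by
      rw [← sub_eq_iff_eq_add] at hg
      rw [← hg]
      simp only [diff, map_sub, map_mul, sub_mul, one_mul]; ring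
    rw [h1, ← diff_shift, shift_trans_diff, ← h, hH, map_add, shift_shift, shift_shift,
      add_comm 1 α]
  · have h1 : shift (e + 1) (X * p) + shift 1 (X * g) = diff (shift 1 g) := by
      rw [diff_shift, hg, map_add, shift_shift, add_comm 1 e]
    rw [h1, trans_diff, ← h, diff_add, hH]
    simp only [diff, shift_shift]; ring

theorem flow_free {g H : ZSeries} (h : H = trans ((1 - X) * g)) :
    shift 1 (X * H) = diff (trans (shift 1 (X * g))) := by
  rw [h, shift_X_mul_trans]

/-- A bound colour d follows a bound colour c ending in the first symbol of d. The equations of p',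
r' are those of g, H up to a substitution, so x = g(qz) serves in `bound_step'`. -/
theorem pre_chain {e e' : ℕ} {g H p r p' r' : ZSeries}
    (hg : diff g = shift e (X * p) + X * g)
    (hH : diff (diff H) = shift (e + 1) (X * r) + shift 2 (X * H))
    (h : H = trans (shift 1 g)) (hg0 : coeff 0 g = 0) (hH0 : coeff 0 H = 0)
    (hp : diff p' = shift (e + e') (X * p) + shift e' (X * g))
    (hr : diff (diff r') = shift (e + e') (X * r) + shift (e' + 1) (X * H))
    (hp0 : coeff 0 p' = 0) (hr0 : coeff 0 r' = 0) :
    shift 1 p' = shift e' (shift 1 g) ∧ shift 1 r' = shift e' (trans (shift 1 g)) := by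
  constructor
  · rw [shift_shift, add_comm, ← shift_shift]
    congr 1
    refine diff_cancel ?_ (by rw [hp0, coeff_shift, hg0, mul_zero])
    rw [hp, diff_shift, hg, map_add, shift_shift, add_comm e']
  · rw [← h]
    refine diff_diff_cancel ?_ (by rw [coeff_shift, coeff_shift, hr0, hH0, mul_zero, mul_zero])
    rw [diff_shift, diff_shift, diff_shift, diff_shift, hr, hH, map_add, map_add]
    simp only [shift_shift]
    congr 3 <;> ring

/-- A bound colour d that does not link to the end of the kernel comes either directly or after the
free colour with its a-symbol, whose series are g and H. Here the direct contribution is that of the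
free colour up to z ↦ q^e' z. -/
theorem pre_gap_zero {e' : ℕ} {g H Y p' r' : ZSeries}
    (hg : diff g = X * g + Y)
    (hH : diff (diff H) = diff (trans Y) + shift 2 (X * H)) (h0 : coeff 0 H = coeff 0 g)
    (hp : diff p' = shift e' Y + shift e' (X * g))
    (hr : diff (diff r') = shift e' (diff (trans Y)) + shift (e' + 1) (X * H))
    (hp0 : coeff 0 p' = coeff 0 g) (hr0 : coeff 0 r' = coeff 0 g) :
    shift 1 p' = shift e' (shift 1 g) ∧ shift 1 r' = shift e' (trans (shift 1 g)) := by
  have h := free_step hg hH h0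
  constructor
  · rw [shift_shift, add_comm, ← shift_shift]
    congr 1
    refine diff_cancel ?_ (by rw [hp0, coeff_shift]; simp)
    rw [hp, diff_shift, hg, map_add, add_comm]
  · refine diff_diff_cancel ?_ ?_
    · rw [diff_shift, diff_shift, diff_shift, diff_shift, hr, ← shift_trans_diff, trans_diff, ← h,
        diff_shift, diff_add, hH, map_add]
      simp only [diff, map_add, map_sub, shift_shift]; ring_nf
    · rw [coeff_shift, coeff_shift, hr0, coeff_zero_trans, coeff_shift]; simp

/-- As in `pre_gap_zero`, but the direct contributions A, B agree with those of the free colour only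
after an extra z ↦ qz; this changes x from g(qz) to (1-z)g. -/
theorem pre_gap_one {e' : ℕ} {g H Y p' r' A B : ZSeries}
    (hg : diff g = X * g + Y)
    (hH : diff (diff H) = diff (trans Y) + shift 2 (X * H)) (h0 : coeff 0 H = coeff 0 g)
    (hA : shift 1 A = shift e' Y) (hB : shift 1 B = shift e' (diff (trans Y)))
    (hp : diff p' = A + shift e' (X * g))
    (hr : diff (diff r') = B + shift (e' + 1) (X * H))
    (hp0 : coeff 0 p' = coeff 0 g) (hr0 : coeff 0 r' = coeff 0 g) :
    shift 1 p' = shift e' ((1 - X) * g) ∧ shift 1 r' = shift e' (trans ((1 - X) * g)) := by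
  have h := free_step hg hH h0
  constructor
  · refine diff_cancel ?_ (by rw [coeff_shift, hp0, coeff_shift]; simp)
    rw [diff_shift, hp, map_add, hA, diff_shift, shift_shift, add_comm 1 e', ← shift_shift,
      ← map_add, ← sub_eq_iff_eq_add'.2 hg]
    congr 1
    simp only [diff, map_sub, map_mul, sub_mul, one_mul]; ring
  · rw [← h]
    refine diff_diff_cancel ?_ (by rw [coeff_shift, hr0, coeff_shift, h0]; simp)
    rw [diff_shift, diff_shift, hr, map_add, hB, diff_shift, diff_shift, hH, map_add, shift_shift,
      shift_shift]
    congr 3; ring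

/-! ### Partial fractions: summing coefficients over 1-q^s -/

theorem X_pow_dvd_eulerCoeff (J : ℕ) : X ^ J ∣ eulerCoeff J := by
  rw [eulerCoeff, sum_range_succ, pow_add]
  exact dvd_mul_of_dvd_left (dvd_mul_of_dvd_right (dvd_mul_left _ _) _) _

/-- By `eulerCoeff_succ` the terms telescope; the boundary term is divisible by q^J, so in the limit
a factor 1-q^m raises m by one. -/
theorem sum_eulerCoeff_rec {m : ℕ} (hm : m ≠ 0) (J : ℕ) :
    (1 - X ^ m) * ∑ j ∈ range (J + 1), eulerCoeff j * invOneSub (m + j) =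
      eulerCoeff J + ∑ j ∈ range J, eulerCoeff j * invOneSub (m + 1 + j) := by
  induction J with
  | zero =>
    rw [sum_range_one, sum_range_zero]
    linear_combination eulerCoeff 0 * one_sub_mul_invOneSub hm
  | succ J ih =>
    rw [sum_range_succ, mul_add, ih, sum_range_succ _ J]
    have h1 := eulerCoeff_succ J
    have h2 := one_sub_mul_invOneSub (m := m + 1 + J) (by omega)
    rw [show m + (J + 1) = m + 1 + J by ring]
    have h3 : (X : PowerSeries ℤ) ^ (m + 1 + J) = X ^ m * X ^ (J + 1) := by ring
    rw [h3] at h2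
    linear_combination (-X ^ m * invOneSub (m + 1 + J)) * h1 +
      (eulerCoeff (J + 1) - eulerCoeff J) * h2

theorem sum_eulerCoeff_one (J : ℕ) :
    ∑ j ∈ range J, eulerCoeff j * invOneSub (0 + 1 + j) = 1 - eulerCoeff J := by
  induction J with
  | zero => simp [eulerCoeff, invPoch]
  | succ J ih =>
    rw [sum_range_succ, ih]
    have h1 := eulerCoeff_succ J
    have h2 := one_sub_mul_invOneSub (m := 0 + 1 + J) (by omega)
    rw [show 0 + 1 + J = J + 1 by ring] at h2 ⊢
    linear_combination invOneSub (J + 1) * h1 - (eulerCoeff (J + 1) - eulerCoeff J) * h2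

theorem invPoch_succ (m : ℕ) : invPoch (m + 1) = invPoch m * invOneSub (m + 1) :=
  prod_range_succ _ _

/-- Truncated partial fractions. -/
theorem partial_fraction (m J : ℕ) :
    X ^ J ∣ invPoch (m + 1) * ∑ j ∈ range J, eulerCoeff j * invOneSub (m + 1 + j) -
      invOneSub (m + 1) := by
  induction m generalizing J with
  | zero =>
    rw [sum_eulerCoeff_one, invPoch_succ, invPoch_zero]
    obtain ⟨c, hc⟩ := X_pow_dvd_eulerCoeff J
    exact ⟨-invOneSub 1 * c, by rw [hc]; ring⟩
  | succ m ih =>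
    have h := sum_eulerCoeff_rec (Nat.succ_ne_zero m) J
    rw [Nat.succ_eq_add_one] at h
    -- One term more than in the goal, since the recursion turns J+1 terms into J.
    obtain ⟨c, hc⟩ := ih (J + 1)
    obtain ⟨d, hd⟩ := X_pow_dvd_eulerCoeff J
    rw [hd] at h
    refine ⟨invOneSub (m + 1 + 1) * ((1 - X ^ (m + 1)) * X * c - invPoch (m + 1) * d), ?_⟩
    rw [invPoch_succ (m + 1)]
    linear_combination (invOneSub (m + 1 + 1) * (1 - X ^ (m + 1))) * hc -
      invOneSub (m + 1 + 1) * invPoch (m + 1) * h +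
      invOneSub (m + 1 + 1) * one_sub_mul_invOneSub (m := m + 1) (by omega)

/-- After exchanging sums, each coefficient of Y meets the truncated sum of `partial_fraction`;
divisibility of the coefficient supplies the missing powers of q. -/
theorem sum_trans (Y : ZSeries) (h0 : coeff 0 Y = 0) (hY : ∀ s, X ^ s ∣ coeff s Y) (N : ℕ) :
    X ^ (N + 1) ∣ ∑ s ∈ range N, invOneSub (s + 1) * coeff (s + 1) (trans Y) -
      ∑ s ∈ range N, invOneSub (s + 1) * coeff (s + 1) Y := by
  have h1 : ∀ s, invOneSub (s + 1) * coeff (s + 1) (trans Y) = ∑ k ∈ range (s + 1),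
      coeff (k + 1) Y * (invPoch (k + 1) *
        (eulerCoeff (s - k) * invOneSub (k + 1 + (s - k)))) := by
    intro s
    rw [trans, coeff_mul, Finset.Nat.sum_antidiagonal_succ, coeff_borel, h0, mul_zero, zero_mul,
      zero_add, Finset.Nat.sum_antidiagonal_eq_sum_range_succ_mk, mul_sum]
    refine sum_congr rfl fun k hk => ?_
    have : k + 1 + (s - k) = s + 1 := by have := mem_range.1 hk; omega
    rw [this, coeff_borel, eulerSeries, coeff_mk]; ring
  rw [sum_congr rfl fun s _ => h1 s, sum_range_diag_flip N (fun k j => coeff (k + 1) Y *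
    (invPoch (k + 1) * (eulerCoeff j * invOneSub (k + 1 + j)))), ← sum_sub_distrib]
  refine dvd_sum fun k hk => ?_
  rw [← mul_sum, ← mul_sum]
  have h2 : (X : PowerSeries ℤ) ^ (N + 1) = X ^ (k + 1) * X ^ (N - k) := by
    rw [← pow_add]; congr 1; have := mem_range.1 hk; omega
  rw [h2, mul_comm (invOneSub _), ← mul_sub]
  exact mul_dvd_mul (hY _) (partial_fraction k (N - k))

/-! ### Backwards words and their reduction -/

section Words

variable {n : ℕ}

/-- The words of given length in the colours. Words are read backwards: the first letter of the
list is the last colour of the colour sequence. -/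
def words (n : ℕ) : ℕ → Finset (List (Colour n))
  | 0 => {[]}
  | s + 1 => (univ ×ˢ words n s).image fun p => p.1 :: p.2

theorem mem_words {s : ℕ} {L : List (Colour n)} : L ∈ words n s ↔ L.length = s := by
  induction s generalizing L with
  | zero => simp [words]
  | succ s ih =>
    rw [words, mem_image]
    constructor
    · rintro ⟨p, hp, rfl⟩
      simpa [ih] using hp
    · intro h
      cases L with
      | nil => simp at h
      | cons c L => exact ⟨(c, L), by simpa [ih] using h, rfl⟩

theorem sum_words_succ {M : Type*} [AddCommMonoid M] (s : ℕ) (f : List (Colour n) → M) :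
    ∑ L ∈ words n (s + 1), f L = ∑ c : Colour n, ∑ L ∈ words n s, f (c :: L) := by
  rw [words, sum_image, sum_product]
  rintro ⟨c, L⟩ - ⟨d, K⟩ - h
  simpa using h

/-- Append the colour `d` to a reduced (backwards) word and reduce. -/
def rcons (d : Colour n) : List (Colour n) → List (Colour n)
  | [] => [d]
  | c :: R =>
    if c.2 = d.1 ∧ d.1 = d.2 then c :: R
    else if c.1 = c.2 ∧ c.2 = d.1 then d :: R
    else d :: c :: R

/-- The reduction of a backwards word. -/
def rker : List (Colour n) → List (Colour n)
  | [] => []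
  | d :: L => rcons d (rker L)

/-- Backwards words that admit no removal. -/
def RReduced (T : List (Colour n)) : Prop :=
  T.IsChain fun d c => ¬(c.2 = d.1 ∧ (d.1 = d.2 ∨ c.1 = c.2))

theorem RReduced.rcons {R : List (Colour n)} (h : RReduced R) (d : Colour n) :
    RReduced (rcons d R) := by
  unfold RReduced at *
  cases R with
  | nil => simp [Primc.rcons]
  | cons c R =>
    rw [Primc.rcons]
    split_ifs with h1 h2
    · exact h
    · cases R with
      | nil => simp
      | cons b R =>
        rw [List.isChain_cons_cons] at h ⊢
        refine ⟨?_, h.2⟩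
        have := h.1
        grind
    · rw [List.isChain_cons_cons]
      exact ⟨by grind, h⟩

theorem rreduced_rker (L : List (Colour n)) : RReduced (rker L) := by
  induction L with
  | nil => exact List.IsChain.nil
  | cons d L ih => exact ih.rcons d

theorem rcons_ne_nil (d : Colour n) (R : List (Colour n)) : rcons d R ≠ [] := by
  cases R with
  | nil => simp [rcons]
  | cons c R => rw [rcons]; split_ifs <;> simp

theorem Removal.append {C D : List (Colour n)} (h : Removal C D) (E : List (Colour n)) :
    Removal (C ++ E) (D ++ E) := by
  cases h with
  | right X Y k l => simpa using Removal.right X (Y ++ E) k l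
  | left X Y k l => simpa using Removal.left X (Y ++ E) k l

theorem removals_rker (L : List (Colour n)) :
    Relation.ReflTransGen Removal L.reverse (rker L).reverse := by
  induction L with
  | nil => exact Relation.ReflTransGen.refl
  | cons d L ih =>
    rw [List.reverse_cons]
    refine (ih.lift (fun l => l ++ [d]) fun _ _ h => h.append [d]).trans ?_
    rw [rker]
    obtain ⟨k, l⟩ := d
    rcases rker L with _ | ⟨⟨i, j⟩, R⟩
    · exact Relation.ReflTransGen.refl
    · rw [rcons]
      dsimp only
      split_ifs with h1 h2
      · obtain ⟨rfl, rfl⟩ := h1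
        simpa using Relation.ReflTransGen.single (Removal.right R.reverse [] i j)
      · obtain ⟨rfl, rfl⟩ := h2
        simpa using Relation.ReflTransGen.single (Removal.left R.reverse [] i l)
      · simpa using Relation.ReflTransGen.refl

theorem RReduced.not_removal {T : List (Colour n)} (h : RReduced T) (E : List (Colour n)) :
    ¬ Removal T.reverse E := by
  have h' : T.reverse.IsChain fun c d => ¬(c.2 = d.1 ∧ (d.1 = d.2 ∨ c.1 = c.2)) :=
    List.isChain_reverse.2 h
  intro hE
  generalize T.reverse = C at *
  cases hE with
  | right X Y k l =>
    have := (List.isChain_append.1 h').2.1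
    rw [List.isChain_cons_cons] at this
    exact this.1 ⟨rfl, Or.inl rfl⟩
  | left X Y k l =>
    have := (List.isChain_append.1 h').2.1
    rw [List.isChain_cons_cons] at this
    exact this.1 ⟨rfl, Or.inr rfl⟩

theorem reduce_reverse (L : List (Colour n)) : reduce L.reverse = (rker L).reverse :=
  (eq_reduce (removals_rker L) (rreduced_rker L).not_removal).symm

/-- Reduction keeps the last b-symbol, which leaves only two possible last letters for a given
kernel. -/
theorem rcons_eq_cons {c t : Colour n} {R T : List (Colour n)} (h : rcons c R = t :: T) :
    c = t ∨ c = (t.2, t.2) := by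
  obtain ⟨k, l⟩ := c
  cases R with
  | nil => simp only [rcons] at h; grind
  | cons b R => simp only [rcons] at h; grind

theorem rcons_eq_iff_of_bound {t : Colour n} {R T : List (Colour n)} (hR : RReduced R)
    (ht : t.1 ≠ t.2) : rcons (t.2, t.2) R = t :: T ↔ R = t :: T := by
  cases R with
  | nil => simp only [rcons]; grind
  | cons b R => simp only [rcons]; grind

theorem rcons_eq_iff_of_free {l : Fin n} {R T : List (Colour n)} (hR : RReduced R)
    (hT : RReduced ((l, l) :: T)) :
    rcons (l, l) R = (l, l) :: T ↔ R = (l, l) :: T ∨ R = T := by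
  unfold RReduced at *
  cases R with
  | nil => cases T <;> simp [rcons]
  | cons b R =>
    cases T with
    | nil => simp only [rcons]; grind
    | cons c T =>
      rw [List.isChain_cons_cons] at hT
      simp only [rcons]; grind

/-- A free colour between c and d would already have been absorbed by c, so there is only one
predecessor. -/
theorem rcons_eq_iff_of_chain {d c : Colour n} {R T : List (Colour n)} (hR : RReduced R)
    (hT : RReduced (d :: c :: T)) (hd : d.1 ≠ d.2) (hc : c.2 = d.1) :
    rcons d R = d :: c :: T ↔ R = c :: T := by
  unfold RReduced at *
  rw [List.isChain_cons_cons] at hT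
  cases R with
  | nil => simp only [rcons]; grind
  | cons b R =>
    cases R with
    | nil => simp only [rcons]; grind
    | cons a R =>
      rw [List.isChain_cons_cons] at hR
      simp only [rcons]; grind

/-- Without a link to `T`, a free colour before d survives in the kernel until d removes it; hence
two predecessors. -/
theorem rcons_eq_iff_of_gap {d : Colour n} {R T : List (Colour n)} (hR : RReduced R)
    (hd : d.1 ≠ d.2) (hT : ∀ c ∈ T.head?, c.2 ≠ d.1) :
    rcons d R = d :: T ↔ R = T ∨ R = (d.1, d.1) :: T := by
  unfold RReduced at *
  obtain ⟨k, l⟩ := d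
  cases R with
  | nil => cases T <;> simp [rcons]
  | cons b R =>
    obtain ⟨i, j⟩ := b
    cases T with
    | nil => simp only [rcons]; grind
    | cons c T => simp only [rcons]; grind

end Words

/-! ### Generating functions by kernel and last colour -/

section States

variable {n : ℕ} (δ : Colour n → Colour n → ℕ) (m : ℕ)

/-- The generating function of the sequences with the given (backwards) colour word, minimal
differences `δ` and last entry `0`, one factor `1 / (1 - q ^ s)` being repeated `m` times. -/
noncomputable def wt : List (Colour n) → PowerSeries ℤ
  | [] => 1
  | [_] => 1
  | d :: c :: L => wt (c :: L) * X ^ ((L.length + 1) * δ c d) * invOneSub (L.length + 1) ^ m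

/-- The generating function of the words with kernel `T` and last colour `c`; the power of `z` is
the number of the other letters. -/
noncomputable def state (T : List (Colour n)) (c : Colour n) : ZSeries :=
  mk fun s => ∑ L ∈ words n s with rker (c :: L) = T, wt δ m (c :: L)

/-- The generating function of the words with kernel `T`, a last colour `c` being followed by a
difference `α c`. -/
noncomputable def flow (α : Colour n → ℕ) (T : List (Colour n)) : ZSeries :=
  ∑ c, shift (α c) (X * state δ m T c)

theorem coeff_state_zero (T : List (Colour n)) (c : Colour n) :
    coeff 0 (state δ m T c) = if [c] = T then 1 else 0 := by
  rw [state, coeff_mk, words, sum_filter, sum_singleton]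
  rfl

theorem coeff_flow_zero (α : Colour n → ℕ) (T : List (Colour n)) :
    coeff 0 (flow δ m α T) = 0 := by
  rw [flow, map_sum]
  exact sum_eq_zero fun c _ => by rw [coeff_shift]; simp

theorem coeff_flow_succ (α : Colour n → ℕ) (T : List (Colour n)) (s : ℕ) :
    coeff (s + 1) (flow δ m α T) = ∑ c, ∑ L ∈ words n s with rker (c :: L) = T,
      wt δ m (c :: L) * X ^ ((s + 1) * α c) := by
  rw [flow, map_sum]
  refine sum_congr rfl fun c _ => ?_
  rw [coeff_shift, coeff_succ_X_mul, state, coeff_mk, mul_sum]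
  exact sum_congr rfl fun L _ => by rw [mul_comm (α c), mul_comm]

theorem flow_nil (α : Colour n → ℕ) : flow δ m α [] = 0 := by
  ext1 s
  cases s with
  | zero => rw [coeff_flow_zero, map_zero]
  | succ s =>
    rw [coeff_flow_succ, map_zero]
    refine sum_eq_zero fun c _ => ?_
    rw [filter_false_of_mem, sum_empty]
    exact fun L _ => rcons_ne_nil _ _

theorem state_eq_zero {t c : Colour n} (T : List (Colour n)) (h1 : c ≠ t) (h2 : c ≠ (t.2, t.2)) :
    state δ m (t :: T) c = 0 := by
  ext1 s
  rw [state, coeff_mk, map_zero, filter_false_of_mem, sum_empty]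
  intro L _ h
  rcases rcons_eq_cons h with h | h
  · exact h1 h
  · exact h2 h

theorem flow_bound_eq {t : Colour n} (T : List (Colour n)) (ht : t.1 ≠ t.2) (α : Colour n → ℕ) :
    flow δ m α (t :: T) = shift (α t) (X * state δ m (t :: T) t) +
      shift (α (t.2, t.2)) (X * state δ m (t :: T) (t.2, t.2)) := by
  rw [flow, ← sum_pair (f := fun c => shift (α c) (X * state δ m (t :: T) c))]
  · refine (sum_subset (subset_univ _) fun c _ hc => ?_).symm
    rw [mem_insert, mem_singleton, not_or] at hc
    rw [state_eq_zero δ m T hc.1 hc.2, mul_zero, map_zero]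
  · intro h
    exact ht (congrArg Prod.fst h)

theorem flow_free_eq (l : Fin n) (T : List (Colour n)) (α : Colour n → ℕ) :
    flow δ m α ((l, l) :: T) = shift (α (l, l)) (X * state δ m ((l, l) :: T) (l, l)) := by
  rw [flow, sum_eq_single (l, l) _ (by simp)]
  intro c _ hc
  rw [state_eq_zero δ m T hc hc, mul_zero, map_zero]

theorem coeff_diff_iterate (k s : ℕ) (x : ZSeries) :
    coeff s (diff^[k] x) = (1 - X ^ s) ^ k * coeff s x := by
  induction k with
  | zero => simp
  | succ k ih => rw [Function.iterate_succ_apply', coeff_diff, ih]; ring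

/-- Deletes the last letter: m applications of `diff` cancel the factor 1/(1-q^s)^m it contributed,
and `A` lists the kernels possible before it. -/
theorem diff_state (hm : m ≠ 0) (T : List (Colour n)) (d : Colour n)
    (A : Finset (List (Colour n))) (hA : ∀ R, RReduced R → (rcons d R = T ↔ R ∈ A)) :
    diff^[m] (state δ m T d) = ∑ R ∈ A, flow δ m (fun c => δ c d) R := by
  ext1 s
  rw [coeff_diff_iterate, map_sum]
  cases s with
  | zero =>
    rw [sum_eq_zero fun R _ => coeff_flow_zero δ m _ R]
    -- A one-letter word has no predecessor; its constant term is killed by (1-q^0)^m.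
    simp [hm]
  | succ s =>
    simp_rw [coeff_flow_succ, state, coeff_mk, sum_filter, sum_words_succ]
    rw [sum_comm (s := A), mul_sum]
    refine sum_congr rfl fun c _ => ?_
    rw [sum_comm (s := A), mul_sum]
    refine sum_congr rfl fun L hL => ?_
    rw [sum_ite_eq A (rker (c :: L))]
    have : rker (d :: c :: L) = T ↔ rker (c :: L) ∈ A := hA _ (rreduced_rker _)
    simp only [this, mul_ite, mul_zero]
    split_ifs
    · rw [wt, mem_words.1 hL]
      have := one_sub_mul_invOneSub (Nat.succ_ne_zero s)
      calc _ = ((1 - X ^ (s + 1)) * invOneSub (s + 1)) ^ m *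
            (wt δ m (c :: L) * X ^ ((s + 1) * δ c d)) := by rw [mul_pow]; ring
        _ = _ := by rw [this, one_pow, one_mul]
    · rfl

end States

/-! ### Coloured sequences with a fixed colour word -/

section Sequences

variable {κ : Type} (δ : κ → κ → ℕ)

/-- The minimal difference of an entry of colour `c` and the next larger one. -/
def nextDelta (c : κ) : List κ → ℕ
  | [] => 0
  | d :: _ => δ d c

/-- Coloured sequences, written in increasing order, with colour word `L`, smallest entry at least
`b`, minimal differences `δ` and sum `N`. -/
def seqs [DecidableEq κ] : List κ → ℕ → ℕ → Finset (List (ℕ × κ))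
  | [], _, N => if N = 0 then {[]} else ∅
  | c :: L, b, N => (Icc b N).biUnion fun y =>
      (seqs L (y + nextDelta δ c L) (N - y)).image fun x => (y, c) :: x

/-- The condition on consecutive entries of an increasing coloured sequence. -/
def Spaced (p r : ℕ × κ) : Prop := p.1 + δ r.2 p.2 ≤ r.1

theorem mem_seqs [DecidableEq κ] {L : List κ} {b N : ℕ} {x : List (ℕ × κ)} :
    x ∈ seqs δ L b N ↔ x.map Prod.snd = L ∧ (x.map Prod.fst).sum = N ∧
      x.IsChain (Spaced δ) ∧ ∀ p ∈ x.head?, b ≤ p.1 := by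
  induction L generalizing b N x with
  | nil =>
    rw [seqs]
    cases x with
    | nil => by_cases h : N = 0 <;> simp [h, eq_comm]
    | cons p x => by_cases h : N = 0 <;> simp [h]
  | cons c L ih =>
    simp only [seqs, mem_biUnion, mem_image, mem_Icc, ih]
    constructor
    · rintro ⟨y, ⟨hb, hN⟩, x, ⟨rfl, hs, hc, hh⟩, rfl⟩
      refine ⟨by simp, by simp; omega, ?_, by simpa using hb⟩
      cases x with
      | nil => simp
      | cons r x =>
        rw [List.isChain_cons_cons]
        exact ⟨hh r (by simp), hc⟩
    · rintro ⟨h1, h2, h3, h4⟩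
      cases x with
      | nil => simp at h1
      | cons p x =>
        obtain ⟨y, d⟩ := p
        simp only [List.map_cons, List.cons.injEq, List.sum_cons] at h1 h2
        obtain ⟨rfl, rfl⟩ := h1
        refine ⟨y, ⟨h4 (y, d) (by simp), by omega⟩, x, ⟨rfl, by omega, ?_, ?_⟩, rfl⟩
        · exact h3.tail
        · cases x with
          | nil => simp
          | cons r x =>
            rw [List.isChain_cons_cons] at h3
            simpa [nextDelta, Spaced] using h3.1

/-- The generating function of `seqs δ L b`. -/
noncomputable def seqSeries [DecidableEq κ] (L : List κ) (b : ℕ) : PowerSeries ℤ :=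
  mk fun N => ((seqs δ L b N).card : ℤ)

/-- The generating function of the coloured sequences with word `L` and non-negative entries. -/
noncomputable def seqWeight : List κ → PowerSeries ℤ
  | [] => 1
  | c :: L => seqWeight L * X ^ (L.length * nextDelta δ c L) * invOneSub (L.length + 1)

theorem seqWeight_cons_cons (c d : κ) (L : List κ) : seqWeight δ (c :: d :: L) =
    seqWeight δ (d :: L) * X ^ ((L.length + 1) * δ d c) * invOneSub (L.length + 1 + 1) :=
  rfl

theorem card_seqs_cons [DecidableEq κ] (c : κ) (L : List κ) (b N : ℕ) :
    (seqs δ (c :: L) b N).card =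
      ∑ y ∈ Icc b N, (seqs δ L (y + nextDelta δ c L) (N - y)).card := by
  rw [seqs, card_biUnion]
  · refine sum_congr rfl fun y _ => card_image_of_injective _ fun x x' h => ?_
    simpa using h
  · intro y _ y' _ hy
    rw [Function.onFun, disjoint_left]
    intro x hx hx'
    rw [mem_image] at hx hx'
    obtain ⟨u, _, rfl⟩ := hx
    obtain ⟨v, _, hv⟩ := hx'
    simp only [List.cons.injEq, Prod.mk.injEq, and_true] at hv
    exact hy hv.1.symm

theorem seqSeries_cons [DecidableEq κ] (c : κ) (L : List κ) (b : ℕ) :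
    seqSeries δ (c :: L) b =
      X ^ b * seqSeries δ L (b + nextDelta δ c L) + seqSeries δ (c :: L) (b + 1) := by
  ext N
  rw [map_add, coeff_X_pow_mul', seqSeries, seqSeries, seqSeries, coeff_mk, coeff_mk, coeff_mk,
    card_seqs_cons, card_seqs_cons]
  split_ifs with h
  · rw [← add_sum_Ioc_eq_sum_Icc h, ← Icc_add_one_left_eq_Ioc]
    push_cast
    rfl
  · rw [Icc_eq_empty (by omega), Icc_eq_empty (by omega)]
    simp

theorem eq_zero_of_const {f : ℕ → PowerSeries ℤ} (h : ∀ b, f b = f (b + 1))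
    (hd : ∀ b, X ^ b ∣ f b) (b : ℕ) : f b = 0 := by
  have h1 : ∀ k, f b = f (b + k) := by
    intro k
    induction k with
    | zero => rfl
    | succ k ih => rw [ih, h, add_assoc]
  ext N
  rw [h1 (N + 1), X_pow_dvd_iff.1 (hd _) N (by omega), map_zero]

/-- Both sides obey the recursion `seqSeries_cons` in b, so their difference is independent of b
while divisible by q^b for every b. -/
theorem seqSeries_eq [DecidableEq κ] (L : List κ) (b : ℕ) :
    seqSeries δ L b = X ^ (b * L.length) * seqWeight δ L := by
  induction L generalizing b with
  | nil =>
    ext N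
    simp only [seqSeries, seqs, coeff_mk, seqWeight, List.length_nil, mul_zero, pow_zero, one_mul,
      coeff_one]
    split_ifs <;> simp
  | cons c L ih =>
    rw [← sub_eq_zero]
    refine eq_zero_of_const (f := fun b => seqSeries δ (c :: L) b -
      X ^ (b * (c :: L).length) * seqWeight δ (c :: L)) (fun b => ?_) (fun b => ?_) b
    · rw [seqSeries_cons, ih, seqWeight, List.length_cons]
      have := one_sub_mul_invOneSub (Nat.succ_ne_zero L.length)
      rw [Nat.succ_eq_add_one] at this
      linear_combination (-X ^ (b * (L.length + 1)) * seqWeight δ L *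
        X ^ (L.length * nextDelta δ c L)) * this
    · refine dvd_sub ?_ (dvd_mul_of_dvd_left (pow_dvd_pow _ ?_) _)
      · rw [X_pow_dvd_iff]
        intro N hN
        rw [seqSeries, coeff_mk, card_seqs_cons, Icc_eq_empty (by omega), sum_empty, Nat.cast_zero]
      · exact Nat.le_mul_of_pos_right _ (by simp)

end Sequences

/-! ### From partitions to sums over words -/

variable {n : ℕ}

theorem seqWeight_cons_eq_wt (δ : Colour n → Colour n → ℕ) (c : Colour n) (L : List (Colour n)) :
    seqWeight δ (c :: L) = wt δ 1 (c :: L) * invOneSub (L.length + 1) := by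
  induction L generalizing c with
  | nil => simp [seqWeight, wt]
  | cons d L ih =>
    rw [seqWeight, ih, wt, nextDelta, List.length_cons]; ring

/-- The minimal differences in the upper row. -/
def deltaTop (i j : Fin n) : ℕ := if j ≤ i then 1 else 0

/-- The minimal differences in the lower row. -/
def deltaBottom (i j : Fin n) : ℕ := if i ≤ j then 1 else 0

/-- The minimal differences in `𝒫_n`. -/
def deltaP (c d : Colour n) : ℕ := (Delta c d).toNat

/-- The sum of the minimal differences in the two rows. -/
def deltaF (c d : Colour n) : ℕ := deltaTop c.1 d.1 + deltaBottom c.2 d.2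

/-- The rows are independent once the colours are fixed: exponents add to `deltaF`, and each row
brings its own factor 1/(1-q^s). -/
theorem seqWeight_mul_cons_eq_wt (c : Colour n) (L : List (Colour n)) :
    seqWeight deltaTop ((c :: L).map Prod.fst) * seqWeight deltaBottom ((c :: L).map Prod.snd) =
      wt deltaF 2 (c :: L) * invOneSub (L.length + 1) ^ 2 := by
  induction L generalizing c with
  | nil => simp [seqWeight, wt]; ring
  | cons d L ih =>
    specialize ih d
    simp only [List.map_cons] at ih ⊢
    rw [seqWeight_cons_cons, seqWeight_cons_cons, wt, List.length_map, List.length_map, deltaF,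
      List.length_cons]
    rw [mul_add (L.length + 1), pow_add]
    linear_combination (X ^ ((L.length + 1) * deltaTop d.1 c.1) *
      X ^ ((L.length + 1) * deltaBottom d.2 c.2) * invOneSub (L.length + 1 + 1) ^ 2) * ih

/-- The words of length at most `N`. -/
def wordsLE (n N : ℕ) : Finset (List (Colour n)) := (range (N + 1)).biUnion (words n)

theorem mem_wordsLE {N : ℕ} {L : List (Colour n)} : L ∈ wordsLE n N ↔ L.length ≤ N := by
  simp [wordsLE, mem_words]

theorem sum_wordsLE {M : Type*} [AddCommMonoid M] (N : ℕ) (f : List (Colour n) → M) :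
    ∑ L ∈ wordsLE n N, f L = ∑ s ∈ range (N + 1), ∑ L ∈ words n s, f L := by
  rw [wordsLE, sum_biUnion]
  intro s _ t _ h
  rw [Function.onFun, disjoint_left]
  intro L h1 h2
  exact h ((mem_words.1 h1).symm.trans (mem_words.1 h2))

theorem ncard_of_image {α β : Type*} {S : Set α} {f : α → β} (hf : Function.Injective f)
    {T : Finset β} (h : f '' S = T) : S.Finite ∧ S.ncard = T.card := by
  constructor
  · exact Set.Finite.of_finite_image (h ▸ T.finite_toSet) hf.injOn
  · rw [← Set.ncard_coe_finset, ← h, Set.ncard_image_of_injective S hf]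

theorem Delta_nonneg (c d : Colour n) : 0 ≤ Delta c d := by
  obtain ⟨i, j⟩ := c
  obtain ⟨k, l⟩ := d
  simp only [Delta, chi]
  split_ifs <;> omega

theorem mem_Primc_iff {l : ColouredPartition n} :
    l ∈ PrimcPartitions n ↔ l.parts.reverse.IsChain (Spaced deltaP) := by
  rw [List.isChain_reverse]
  refine List.IsChain.iff fun {p r} => ?_
  have := Delta_nonneg p.2 r.2
  simp only [Spaced, deltaP]
  omega

theorem le_of_spaced {κ : Type} {δ : κ → κ → ℕ} {b : ℕ} {x : List (ℕ × κ)}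
    (h : x.IsChain (Spaced δ)) (hb : ∀ p ∈ x.head?, b ≤ p.1) : ∀ p ∈ x, b ≤ p.1 := by
  induction x generalizing b with
  | nil => simp
  | cons p x ih =>
    have hp : b ≤ p.1 := hb p (by simp)
    intro r hr
    rcases List.mem_cons.1 hr with rfl | hr
    · exact hp
    · refine ih h.tail (fun t ht => ?_) r hr
      cases x with
      | nil => simp at ht
      | cons a x =>
        obtain rfl : a = t := by simpa using ht
        have := (List.isChain_cons_cons.1 h).1
        simp only [Spaced] at this
        omega

theorem coeff_X_pow_mul_seqWeight {κ : Type} [DecidableEq κ] (δ : κ → κ → ℕ) (L : List κ)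
    (b N : ℕ) : coeff N (X ^ (b * L.length) * seqWeight δ L) = ((seqs δ L b N).card : ℤ) := by
  rw [← seqSeries_eq, seqSeries, coeff_mk]

/-- Reversed parts form an increasing sequence with entries at least 1, whence the power of q;
positivity also bounds the word length by N. -/
theorem Primc_count (p : List (Colour n) → Prop) [DecidablePred p] (N : ℕ) :
    {l : ColouredPartition n | l ∈ PrimcPartitions n ∧ p l.colours.reverse ∧
      l.weight = N}.Finite ∧
    ({l : ColouredPartition n | l ∈ PrimcPartitions n ∧ p l.colours.reverse ∧
      l.weight = N}.ncard : ℤ) =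
      ∑ L ∈ wordsLE n N with p L, coeff N (X ^ L.length * seqWeight deltaP L) := by
  have hf : Function.Injective fun l : ColouredPartition n => l.parts.reverse :=
    fun l l' h => ColouredPartition.ext (List.reverse_injective h)
  have key := ncard_of_image
    (S := {l : ColouredPartition n | l ∈ PrimcPartitions n ∧ p l.colours.reverse ∧ l.weight = N})
    hf (T := {L ∈ wordsLE n N | p L}.biUnion fun L => seqs deltaP L 1 N) ?_
  · refine ⟨key.1, ?_⟩
    rw [key.2, card_biUnion]
    · push_cast
      exact sum_congr rfl fun L _ => by rw [← coeff_X_pow_mul_seqWeight, one_mul]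
    · intro L _ L' _ h
      rw [Function.onFun, disjoint_left]
      intro x h1 h2
      exact h ((mem_seqs _).1 h1 |>.1.symm.trans ((mem_seqs _).1 h2).1)
  · ext x
    simp only [Set.mem_image, coe_biUnion, Set.mem_iUnion, mem_coe, mem_filter, mem_wordsLE,
      mem_seqs, exists_prop]
    constructor
    · rintro ⟨l, ⟨h1, h2, rfl⟩, rfl⟩
      refine ⟨l.colours.reverse, ⟨?_, h2⟩, ?_, ?_, mem_Primc_iff.1 h1, ?_⟩
      · have := List.length_le_sum_of_one_le (l.parts.map Prod.fst) (fun i hi => by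
          obtain ⟨r, hr, rfl⟩ := List.mem_map.1 hi
          exact l.pos r hr)
        simpa [ColouredPartition.colours, ColouredPartition.weight] using this
      · simp [ColouredPartition.colours]
      · simp [ColouredPartition.weight]
      · intro r hr
        exact l.pos r (List.mem_reverse.1 (List.mem_of_mem_head? hr))
    · rintro ⟨L, ⟨h1, h2⟩, rfl, h4, h5, h6⟩
      have hs : x.reverse.IsChain fun a c => a.1 ≥ c.1 := by
        rw [List.isChain_reverse]
        exact h5.imp fun a c h => (Nat.le_add_right _ _).trans h
      refine ⟨⟨x.reverse, fun r hr => le_of_spaced h5 h6 r (List.mem_reverse.1 hr), hs⟩,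
        ⟨?_, ?_, ?_⟩, ?_⟩
      · rw [mem_Primc_iff]; simpa using h5
      · simpa [ColouredPartition.colours] using h2
      · simpa [ColouredPartition.weight] using h4
      · simp

theorem top_sorted_iff {x : List (ℕ × Fin n)} :
    x.IsChain TopGT ↔ x.reverse.IsChain (Spaced deltaTop) := by
  rw [List.isChain_reverse]
  refine List.IsChain.iff fun {p r} => ?_
  simp only [Spaced, deltaTop, TopGT]
  split_ifs <;> omega

theorem bottom_sorted_iff {x : List (ℕ × Fin n)} :
    x.IsChain BottomGT ↔ x.reverse.IsChain (Spaced deltaBottom) := by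
  rw [List.isChain_reverse]
  refine List.IsChain.iff fun {p r} => ?_
  simp only [Spaced, deltaBottom, BottomGT]
  split_ifs <;> omega

theorem FrobeniusPartition.colours_eq (F : FrobeniusPartition n) :
    F.colours = (F.top.map Prod.snd).zip (F.bottom.map Prod.snd) := by
  rw [FrobeniusPartition.colours, List.zip_map, List.zip, List.map_zipWith]
  rfl

/-- Here the power of q is the summand s of the weight; the antidiagonal distributes the rest
between the rows. -/
theorem Frobenius_count (p : List (Colour n) → Prop) [DecidablePred p] (N : ℕ) :
    {F : FrobeniusPartition n | p F.colours.reverse ∧ F.weight = N}.Finite ∧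
    ({F : FrobeniusPartition n | p F.colours.reverse ∧ F.weight = N}.ncard : ℤ) =
      ∑ L ∈ wordsLE n N with p L, coeff N (X ^ L.length *
        (seqWeight deltaTop (L.map Prod.fst) * seqWeight deltaBottom (L.map Prod.snd))) := by
  have hf : Function.Injective fun F : FrobeniusPartition n => (F.top.reverse, F.bottom.reverse) :=
    fun F F' h => FrobeniusPartition.ext (List.reverse_injective (congrArg Prod.fst h))
      (List.reverse_injective (congrArg Prod.snd h))
  have key := ncard_of_image
    (S := {F : FrobeniusPartition n | p F.colours.reverse ∧ F.weight = N})
    hf (T := {L ∈ wordsLE n N | p L}.biUnion fun L =>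
      (antidiagonal (N - L.length)).biUnion fun ij =>
        seqs deltaTop (L.map Prod.fst) 0 ij.1 ×ˢ seqs deltaBottom (L.map Prod.snd) 0 ij.2) ?_
  · refine ⟨key.1, ?_⟩
    rw [key.2, card_biUnion]
    · push_cast
      refine sum_congr rfl fun L hL => ?_
      rw [coeff_X_pow_mul', if_pos (mem_wordsLE.1 (mem_filter.1 hL).1), coeff_mul, card_biUnion]
      · push_cast
        refine sum_congr rfl fun ij _ => ?_
        have h1 := coeff_X_pow_mul_seqWeight deltaTop (L.map Prod.fst) 0 ij.1
        have h2 := coeff_X_pow_mul_seqWeight deltaBottom (L.map Prod.snd) 0 ij.2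
        rw [zero_mul, pow_zero, one_mul] at h1 h2
        rw [card_product, h1, h2, Nat.cast_mul]
      · intro ij _ ij' _ h
        rw [Function.onFun, disjoint_left]
        rintro ⟨x, y⟩ h1 h2
        rw [mem_product, mem_seqs, mem_seqs] at h1 h2
        exact h (Prod.ext (h1.1.2.1.symm.trans h2.1.2.1) (h1.2.2.1.symm.trans h2.2.2.1))
    · intro L _ L' _ h
      rw [Function.onFun, disjoint_left]
      rintro ⟨x, y⟩ h1 h2
      rw [mem_biUnion] at h1 h2
      obtain ⟨ij, _, h1⟩ := h1
      obtain ⟨kl, _, h2⟩ := h2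
      rw [mem_product, mem_seqs, mem_seqs] at h1 h2
      refine h ?_
      rw [← List.zip_unzip L, ← List.zip_unzip L', List.unzip_eq_map, List.unzip_eq_map,
        ← h1.1.1, ← h1.2.1, h2.1.1, h2.2.1]
  · ext ⟨x, y⟩
    simp only [Set.mem_image, coe_biUnion, Set.mem_iUnion, mem_coe, mem_filter, mem_wordsLE,
      mem_product, mem_seqs, exists_prop, HasAntidiagonal.mem_antidiagonal, Prod.mk.injEq]
    constructor
    · rintro ⟨F, ⟨h2, rfl⟩, rfl, rfl⟩
      have hl := F.length_eq
      refine ⟨F.colours.reverse, ⟨?_, h2⟩, ((F.top.map Prod.fst).sum, (F.bottom.map Prod.fst).sum),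
        ?_, ⟨?_, ?_, top_sorted_iff.1 F.top_sorted, fun _ _ => Nat.zero_le _⟩,
        ⟨?_, ?_, bottom_sorted_iff.1 F.bottom_sorted, fun _ _ => Nat.zero_le _⟩⟩
      · simp [FrobeniusPartition.colours, FrobeniusPartition.weight, hl]; omega
      · simp [FrobeniusPartition.colours, FrobeniusPartition.weight, hl]; omega
      · rw [F.colours_eq, List.map_reverse, List.map_reverse, List.map_fst_zip (by simp [hl])]
      · simp
      · rw [F.colours_eq, List.map_reverse, List.map_reverse, List.map_snd_zip (by simp [hl])]
      · simp
    · rintro ⟨L, ⟨h1, h2⟩, ij, hij, ⟨a1, a2, a3, a4⟩, ⟨b1, b2, b3, b4⟩⟩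
      have hx : x.length = L.length := by simpa using congrArg List.length a1
      have hy : y.length = L.length := by simpa using congrArg List.length b1
      have hc : (x.reverse.map Prod.snd).zip (y.reverse.map Prod.snd) = L.reverse := by
        rw [List.map_reverse, List.map_reverse, a1, b1, ← List.map_reverse, ← List.map_reverse,
          ← List.unzip_fst, ← List.unzip_snd, List.zip_unzip]
      refine ⟨⟨x.reverse, y.reverse, by simp [hx, hy], by rw [top_sorted_iff]; simpa using a3,
        by rw [bottom_sorted_iff]; simpa using b3⟩, ⟨?_, ?_⟩, ?_, ?_⟩
      · rw [FrobeniusPartition.colours_eq, hc, List.reverse_reverse]; exact h2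
      · simp [FrobeniusPartition.weight, a2, b2, hx]; omega
      · simp
      · simp

/-! ### Values of the minimal differences -/

/-- `χ(i > k)` for the colour `a_i b_k`. -/
def desc (c : Colour n) : ℕ := if c.2 < c.1 then 1 else 0

/-- `χ(i < k)` for the colour `a_i b_k`. -/
def asc (c : Colour n) : ℕ := if c.1 < c.2 then 1 else 0

theorem desc_add_asc {c : Colour n} (hc : c.1 ≠ c.2) : desc c + asc c = 1 := by
  simp only [desc, asc]; split_ifs <;> omega

theorem deltaP_cast (c d : Colour n) : (deltaP c d : ℤ) = Delta c d :=
  Int.toNat_of_nonneg (Delta_nonneg c d)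

theorem deltaP_free_self (l : Fin n) : deltaP (l, l) (l, l) = 0 := by
  simp [deltaP, Delta, chi]

theorem deltaF_free_self (l : Fin n) : deltaF (l, l) (l, l) = 2 := by
  simp [deltaF, deltaTop, deltaBottom]

theorem deltaP_bound_free {c : Colour n} (hc : c.1 ≠ c.2) : deltaP c (c.2, c.2) = desc c := by
  zify
  rw [deltaP_cast]
  simp only [Delta, chi, desc]
  split_ifs <;> grind

theorem deltaF_bound_free {c : Colour n} (hc : c.1 ≠ c.2) :
    deltaF c (c.2, c.2) = desc c + 1 := by
  simp only [deltaF, deltaTop, deltaBottom, desc]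
  split_ifs <;> omega

theorem deltaP_eq_deltaF {c d : Colour n} (hc : c.2 ≠ d.1) : deltaP c d = deltaF c d := by
  zify
  rw [deltaP_cast]
  simp only [deltaF, deltaTop, deltaBottom, Delta, chi]
  split_ifs <;> omega

theorem deltaF_free_free {k l : Fin n} (h : k ≠ l) : deltaF (k, k) (l, l) = 1 := by
  simp only [deltaF, deltaTop, deltaBottom]
  split_ifs <;> omega

theorem deltaF_to_free {c : Colour n} {l : Fin n} (h : c.2 ≠ l) :
    deltaF c (l, l) = desc c ∨ deltaF c (l, l) = desc c + 1 := by
  simp only [deltaF, deltaTop, deltaBottom, desc]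
  split_ifs <;> omega

theorem deltaP_free_bound {d : Colour n} (hd : d.1 ≠ d.2) : deltaP (d.1, d.1) d = asc d := by
  zify
  rw [deltaP_cast]
  simp only [Delta, chi, asc]
  split_ifs <;> grind

theorem deltaF_free_bound {d : Colour n} (hd : d.1 ≠ d.2) :
    deltaF (d.1, d.1) d = asc d + 1 := by
  simp only [deltaF, deltaTop, deltaBottom, asc]
  split_ifs <;> omega

theorem deltaP_chain {c d : Colour n} (h : c.2 = d.1) :
    deltaP c d = desc c + asc d := by
  zify
  rw [deltaP_cast]
  simp only [Delta, chi, asc, desc]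
  split_ifs <;> omega

theorem deltaF_chain {c d : Colour n} (hc : c.1 ≠ c.2) (hd : d.1 ≠ d.2) (h : c.2 = d.1) :
    deltaF c d = desc c + asc d := by
  simp only [deltaF, deltaTop, deltaBottom, asc, desc]
  split_ifs <;> omega

/-- d and the free colour share their a-symbol, so the upper row cancels and r depends only on the
last b-symbol, hence only on the kernel. -/
theorem deltaF_gap (d : Colour n) (y : Fin n) :
    ∃ r, (r = 0 ∨ r = 1) ∧
      ∀ c : Colour n, c.2 = y → r + deltaF c d = asc d + deltaF c (d.1, d.1) := by
  -- The truncated subtraction is exact: d.1 < y ≤ d.2 forces `asc d = 1`.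
  refine ⟨asc d + deltaBottom y d.1 - deltaBottom y d.2, ?_, fun c hc => ?_⟩ <;>
  simp only [deltaF, deltaTop, deltaBottom, asc, *] <;>
  split_ifs <;> omega

/-! ### Induction on the kernel -/

/-- The invariant relating the two sides, for the (backwards) kernel `T`. -/
def Related : List (Colour n) → Prop
  | [] => True
  | t :: T => state deltaF 2 (t :: T) (t.2, t.2) =
      trans (if t.1 = t.2 then (1 - X) * state deltaP 1 (t :: T) (t.2, t.2)
        else shift 1 (state deltaP 1 (t :: T) (t.2, t.2)))

theorem trans_zero : trans 0 = 0 := by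
  have := trans_sub 0 0
  rwa [sub_self, sub_self] at this

theorem diff_zero : diff 0 = 0 := by
  rw [diff, map_zero, sub_zero]

theorem shift_flow_congr (δ : Colour n → Colour n → ℕ) (m : ℕ) {α β : Colour n → ℕ} {r e : ℕ}
    {T : List (Colour n)} (h : ∀ t ∈ T.head?, ∀ c : Colour n, c.2 = t.2 → r + α c = e + β c) :
    shift r (flow δ m α T) = shift e (flow δ m β T) := by
  cases T with
  | nil => rw [flow_nil, flow_nil, map_zero, map_zero]
  | cons t T =>
    rw [flow, flow, map_sum, map_sum]
    refine sum_congr rfl fun c _ => ?_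
    by_cases hc : c.2 = t.2
    · rw [shift_shift, shift_shift, h t (by simp) c hc]
    · rw [state_eq_zero δ m T (fun h => hc (by rw [h]))
        (fun h => hc (by rw [h])), mul_zero, map_zero,
        map_zero, map_zero, map_zero]

theorem flow_congr (δ : Colour n → Colour n → ℕ) (m : ℕ) {α β : Colour n → ℕ}
    {T : List (Colour n)} (h : ∀ t ∈ T.head?, ∀ c : Colour n, c.2 = t.2 → α c = β c) :
    flow δ m α T = flow δ m β T :=
  shift_injective 0 (shift_flow_congr δ m fun t ht c hc => by rw [h t ht c hc])

theorem diff_state_bound {t : Colour n} (T : List (Colour n)) (ht : t.1 ≠ t.2) :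
    diff (state deltaP 1 (t :: T) (t.2, t.2)) =
      shift (desc t) (X * state deltaP 1 (t :: T) t) + X * state deltaP 1 (t :: T) (t.2, t.2) ∧
    diff (diff (state deltaF 2 (t :: T) (t.2, t.2))) =
      shift (desc t + 1) (X * state deltaF 2 (t :: T) t) +
        shift 2 (X * state deltaF 2 (t :: T) (t.2, t.2)) := by
  have h1 := diff_state deltaP 1 one_ne_zero (t :: T) (t.2, t.2) {t :: T}
    fun R hR => by rw [mem_singleton, rcons_eq_iff_of_bound hR ht]
  have h2 := diff_state deltaF 2 two_ne_zero (t :: T) (t.2, t.2) {t :: T}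
    fun R hR => by rw [mem_singleton, rcons_eq_iff_of_bound hR ht]
  rw [sum_singleton, flow_bound_eq _ _ _ ht, deltaP_bound_free ht, deltaP_free_self,
    shift_zero] at h1
  rw [sum_singleton, flow_bound_eq _ _ _ ht, deltaF_bound_free ht, deltaF_free_self] at h2
  exact ⟨h1, h2⟩

/-- Extends the invariant from the last free colour to all words with kernel T. The conditions on α
cover both appending a free colour and the final constant difference 1. -/
theorem flow_trans {T : List (Colour n)} (hT : Related T) (α : Colour n → ℕ)
    (h1 : ∀ t ∈ T.head?, α (t.2, t.2) = 1)
    (h2 : ∀ t ∈ T.head?, t.1 ≠ t.2 → α t = desc t ∨ α t = desc t + 1) :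
    flow deltaF 2 α T = diff (trans (flow deltaP 1 α T)) := by
  cases T with
  | nil => rw [flow_nil, flow_nil, trans_zero, diff_zero]
  | cons t T =>
    rw [Related] at hT
    specialize h1 t (by simp)
    specialize h2 t (by simp)
    by_cases ht : t.1 = t.2
    · rw [if_pos ht] at hT
      obtain ⟨k, l⟩ := t
      dsimp only at *
      subst ht
      rw [flow_free_eq, flow_free_eq, h1, flow_free hT]
    · rw [if_neg ht] at hT
      obtain ⟨hg, hH⟩ := diff_state_bound T ht
      rw [flow_bound_eq _ _ _ ht, flow_bound_eq _ _ _ ht, h1, flow_bound (h2 ht) hg hH hT]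

theorem flow_trans_free {T : List (Colour n)} {l : Fin n} (hT : Related T)
    (hl : ∀ t ∈ T.head?, t.2 ≠ l) :
    flow deltaF 2 (fun c => deltaF c (l, l)) T =
      diff (trans (flow deltaP 1 (fun c => deltaP c (l, l)) T)) := by
  rw [flow_trans hT (fun c => deltaF c (l, l)) (fun t ht => deltaF_free_free (hl t ht))
    (fun t ht _ => deltaF_to_free (hl t ht)),
    flow_congr deltaP 1 (α := fun c => deltaP c (l, l))]
  intro t ht c hc
  exact deltaP_eq_deltaF (hc ▸ hl t ht)

theorem rreduced_free_cons {T : List (Colour n)} {l : Fin n} (hT : RReduced T)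
    (hl : ∀ t ∈ T.head?, t.2 ≠ l) : RReduced ((l, l) :: T) := by
  cases T with
  | nil => exact List.IsChain.singleton _
  | cons t T => exact List.isChain_cons_cons.2 ⟨fun h => hl t (by simp) h.1, hT⟩

theorem diff_state_free {T : List (Colour n)} {l : Fin n} (hT : RReduced T) (hr : Related T)
    (hl : ∀ t ∈ T.head?, t.2 ≠ l) :
    diff (state deltaP 1 ((l, l) :: T) (l, l)) =
      X * state deltaP 1 ((l, l) :: T) (l, l) + flow deltaP 1 (fun c => deltaP c (l, l)) T ∧
    diff (diff (state deltaF 2 ((l, l) :: T) (l, l))) =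
      diff (trans (flow deltaP 1 (fun c => deltaP c (l, l)) T)) +
        shift 2 (X * state deltaF 2 ((l, l) :: T) (l, l)) := by
  have hne : (l, l) :: T ≠ T := by simp
  have h1 := diff_state deltaP 1 one_ne_zero ((l, l) :: T) (l, l) {(l, l) :: T, T}
    fun R hR => by
      rw [mem_insert, mem_singleton, rcons_eq_iff_of_free hR (rreduced_free_cons hT hl)]
  have h2 := diff_state deltaF 2 two_ne_zero ((l, l) :: T) (l, l) {(l, l) :: T, T}
    fun R hR => by
      rw [mem_insert, mem_singleton, rcons_eq_iff_of_free hR (rreduced_free_cons hT hl)]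
  rw [sum_pair hne, flow_free_eq, deltaP_free_self, shift_zero] at h1
  rw [sum_pair hne, flow_free_eq, deltaF_free_self, flow_trans_free hr hl, add_comm] at h2
  exact ⟨h1, h2⟩

theorem Related.free_cons {T : List (Colour n)} {l : Fin n} (hT : RReduced T) (hr : Related T)
    (hl : ∀ t ∈ T.head?, t.2 ≠ l) : Related ((l, l) :: T) := by
  obtain ⟨h1, h2⟩ := diff_state_free hT hr hl
  rw [Related, if_pos rfl]
  exact free_step h1 h2 (by rw [coeff_state_zero, coeff_state_zero])

/-- It suffices to know the two series of words ending in d itself, up to z ↦ q^(asc d) z;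
`bound_step'` handles those ending in the free colour. -/
theorem Related.bound_cons_aux {T : List (Colour n)} {d : Colour n} (hd : d.1 ≠ d.2)
    (h : ∃ x, shift 1 (state deltaP 1 (d :: T) d) = shift (asc d) x ∧
      shift 1 (state deltaF 2 (d :: T) d) = shift (asc d) (trans x)) : Related (d :: T) := by
  obtain ⟨h1, h2⟩ := diff_state_bound T hd
  obtain ⟨x, hx1, hx2⟩ := h
  have h0 : ¬ [(d.2, d.2)] = d :: T := fun h => hd (by
    rw [List.cons.injEq] at h
    exact (congrArg Prod.fst h.1).symm)
  rw [Related, if_neg hd]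
  exact bound_step' (desc_add_asc hd) h1 h2 hx1 hx2 (by rw [coeff_state_zero, if_neg h0])
    (by rw [coeff_state_zero, if_neg h0])

theorem Related.chain_cons {T : List (Colour n)} {d c : Colour n} (hT : RReduced (d :: c :: T))
    (hr : Related (c :: T)) (hd : d.1 ≠ d.2) (hc : c.1 ≠ c.2) (hcd : c.2 = d.1) :
    Related (d :: c :: T) := by
  obtain ⟨hg, hH⟩ := diff_state_bound T hc
  have h1 := diff_state deltaP 1 one_ne_zero (d :: c :: T) d {c :: T}
    fun R hR => by rw [mem_singleton, rcons_eq_iff_of_chain hR hT hd hcd]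
  have h2 := diff_state deltaF 2 two_ne_zero (d :: c :: T) d {c :: T}
    fun R hR => by rw [mem_singleton, rcons_eq_iff_of_chain hR hT hd hcd]
  rw [sum_singleton, flow_bound_eq _ _ _ hc, deltaP_chain hcd, hcd,
    deltaP_free_bound hd, ← hcd] at h1
  rw [sum_singleton, flow_bound_eq _ _ _ hc, deltaF_chain hc hd hcd, hcd,
    deltaF_free_bound hd, ← hcd] at h2
  rw [Related, if_neg hc] at hr
  have h0 : ¬ [(c.2, c.2)] = c :: T := fun h => hc (by
    rw [List.cons.injEq] at h
    exact (congrArg Prod.fst h.1).symm)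
  refine Related.bound_cons_aux hd ⟨_, pre_chain hg hH hr ?_ ?_ h1 h2 ?_ ?_⟩ <;>
  simp [coeff_state_zero, h0]

theorem Related.gap_cons {T : List (Colour n)} {d : Colour n} (hT : RReduced T)
    (hr : Related T) (hd : d.1 ≠ d.2) (hl : ∀ t ∈ T.head?, t.2 ≠ d.1) :
    Related (d :: T) := by
  obtain ⟨hg, hH⟩ := diff_state_free hT hr hl
  have hne : T ≠ (d.1, d.1) :: T := by simp
  have h1 := diff_state deltaP 1 one_ne_zero (d :: T) d {T, (d.1, d.1) :: T}
    fun R hR => by rw [mem_insert, mem_singleton, rcons_eq_iff_of_gap hR hd hl]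
  have h2 := diff_state deltaF 2 two_ne_zero (d :: T) d {T, (d.1, d.1) :: T}
    fun R hR => by rw [mem_insert, mem_singleton, rcons_eq_iff_of_gap hR hd hl]
  rw [sum_pair hne, flow_free_eq, deltaP_free_bound hd] at h1
  rw [sum_pair hne, flow_free_eq, deltaF_free_bound hd] at h2
  have h0 : coeff 0 (state deltaF 2 ((d.1, d.1) :: T) (d.1, d.1)) =
      coeff 0 (state deltaP 1 ((d.1, d.1) :: T) (d.1, d.1)) := by
    rw [coeff_state_zero, coeff_state_zero]
  have hp0 : ∀ (δ : Colour n → Colour n → ℕ) m, coeff 0 (state δ m (d :: T) d) =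
      coeff 0 (state deltaP 1 ((d.1, d.1) :: T) (d.1, d.1)) := by
    intro δ m
    rw [coeff_state_zero, coeff_state_zero]
    simp
  -- The same r works for both sides, since without a link `deltaP` and `deltaF` agree.
  obtain ⟨r, hr01, hP, hF⟩ : ∃ r, (r = 0 ∨ r = 1) ∧
      shift r (flow deltaP 1 (fun c => deltaP c d) T) =
        shift (asc d) (flow deltaP 1 (fun c => deltaP c (d.1, d.1)) T) ∧
      shift r (flow deltaF 2 (fun c => deltaF c d) T) =
        shift (asc d) (flow deltaF 2 (fun c => deltaF c (d.1, d.1)) T) := by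
    cases T with
    | nil => exact ⟨0, Or.inl rfl, by simp [flow_nil], by simp [flow_nil]⟩
    | cons t T =>
      have ht : t.2 ≠ d.1 := hl t (by simp)
      obtain ⟨r, hr, h⟩ := deltaF_gap d t.2
      refine ⟨r, hr, shift_flow_congr _ _ fun a ha c hc => ?_,
        shift_flow_congr _ _ fun a ha c hc => ?_⟩
      · obtain rfl : t = a := by simpa using ha
        rw [deltaP_eq_deltaF (hc ▸ ht), deltaP_eq_deltaF (hc ▸ ht)]
        exact h c hc
      · obtain rfl : t = a := by simpa using ha
        exact h c hc
  rw [flow_trans_free hr hl] at hF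
  refine Related.bound_cons_aux hd ?_
  rcases hr01 with rfl | rfl
  · rw [shift_zero] at hP hF
    rw [hP] at h1
    rw [hF] at h2
    exact ⟨_, pre_gap_zero hg hH h0 h1 h2 (hp0 _ _) (hp0 _ _)⟩
  · exact ⟨_, pre_gap_one hg hH h0 hP hF h1 h2 (hp0 _ _) (hp0 _ _)⟩

theorem related_of_rreduced {T : List (Colour n)} (hT : RReduced T) : Related T := by
  induction T with
  | nil => trivial
  | cons d T ih =>
    have hT' : RReduced T := hT.tail
    specialize ih hT'
    by_cases hd : d.1 = d.2
    · obtain ⟨k, l⟩ := d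
      dsimp only at hd
      subst hd
      refine ih.free_cons hT' fun t ht => ?_
      cases T with
      | nil => simp at ht
      | cons a T =>
        obtain rfl : a = t := by simpa using ht
        intro h
        exact (List.isChain_cons_cons.1 hT).1 ⟨h, Or.inl rfl⟩
    · cases T with
      | nil => exact ih.gap_cons hT' hd (by simp)
      | cons c T =>
        by_cases hcd : c.2 = d.1
        · refine ih.chain_cons hT hd (fun hc => ?_) hcd
          exact (List.isChain_cons_cons.1 hT).1 ⟨hcd, Or.inr hc⟩
        · exact ih.gap_cons hT' hd (by simpa using hcd)

/-! ### Comparison for each kernel and conclusion -/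

/-- For each kernel, the generating functions of both sides agree. -/
theorem kernel_count {T : List (Colour n)} (hT : RReduced T) (N : ℕ) :
    ∑ L ∈ wordsLE n N with rker L = T, coeff N (X ^ L.length * seqWeight deltaP L) =
    ∑ L ∈ wordsLE n N with rker L = T, coeff N (X ^ L.length *
        (seqWeight deltaTop (L.map Prod.fst) * seqWeight deltaBottom (L.map Prod.snd))) := by
  -- The constant difference 1 produces q^length; it is admissible because `desc t` is 0 or 1.
  have hflow := flow_trans (related_of_rreduced hT) (fun _ => 1) (fun _ _ => rfl)
    (fun t _ ht => by have := desc_add_asc ht; omega)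
  have hsum := sum_trans (flow deltaP 1 (fun _ => 1) T) (coeff_flow_zero _ _ _ _)
    (fun s => by
      cases s with
      | zero => simp
      | succ s =>
        rw [coeff_flow_succ]
        refine dvd_sum fun c _ => dvd_sum fun L _ => ?_
        rw [mul_one]
        exact dvd_mul_left _ _) N
  have h := (X_pow_dvd_iff.1 hsum N (by omega)).symm
  rw [map_sub, eq_comm, sub_eq_zero, eq_comm, map_sum, map_sum] at h
  rw [sum_filter, sum_filter, sum_wordsLE, sum_wordsLE, sum_range_succ', sum_range_succ']
  congr 1
  · convert h using 1
    · refine sum_congr rfl fun s _ => ?_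
      rw [coeff_flow_succ, sum_words_succ, mul_sum, map_sum]
      refine sum_congr rfl fun c _ => ?_
      rw [mul_sum, map_sum, sum_filter]
      refine sum_congr rfl fun L hL => ?_
      rw [seqWeight_cons_eq_wt, List.length_cons, mem_words.1 hL]
      congr 2; ring
    · refine sum_congr rfl fun s _ => ?_
      have h1 := congrArg (coeff (s + 1)) hflow
      rw [coeff_diff] at h1
      have h2 := one_sub_mul_invOneSub (Nat.succ_ne_zero s)
      rw [Nat.succ_eq_add_one] at h2
      -- The `diff` in `hflow` cancels one of the two factors 1/(1-q^(s+1)).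
      have h3 : invOneSub (s + 1) * coeff (s + 1) (trans (flow deltaP 1 (fun _ => 1) T)) =
          invOneSub (s + 1) ^ 2 * coeff (s + 1) (flow deltaF 2 (fun _ => 1) T) := by
        rw [h1]
        linear_combination (-invOneSub (s + 1) *
          coeff (s + 1) (trans (flow deltaP 1 (fun _ => 1) T))) * h2
      rw [h3, coeff_flow_succ, sum_words_succ, mul_sum, map_sum]
      refine sum_congr rfl fun c _ => ?_
      rw [mul_sum, map_sum, sum_filter]
      refine sum_congr rfl fun L hL => ?_
      rw [seqWeight_mul_cons_eq_wt, List.length_cons, mem_words.1 hL]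
      congr 2; ring
  · rw [words, sum_singleton, sum_singleton]
    simp [seqWeight]

/-- Every removed colour is free, so it does not enter these counts. -/
theorem Removal.boundCount_eq {C D : List (Colour n)} (h : Removal C D) (i : Fin n) :
    boundCountA C i = boundCountA D i ∧ boundCountB C i = boundCountB D i := by
  cases h <;> simp [boundCountA, boundCountB, List.countP_append, List.countP_cons, Colour.IsBound]

theorem boundCount_reduce (C : List (Colour n)) (i : Fin n) :
    boundCountA C i = boundCountA (reduce C) i ∧ boundCountB C i = boundCountB (reduce C) i := by
  generalize hD : reduce C = D
  have h : Relation.ReflTransGen Removal C D := hD ▸ removals_reduce C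
  clear hD
  induction h with
  | refl => exact ⟨rfl, rfl⟩
  | tail _ h ih => exact ⟨ih.1.trans (h.boundCount_eq i).1, ih.2.trans (h.boundCount_eq i).2⟩

/-- The counts agree for every condition that only depends on the kernel. -/
theorem sum_coeff_eq_of_kernel (p : List (Colour n) → Prop) [DecidablePred p]
    (hp : ∀ L, p L ↔ p (rker L)) (N : ℕ) :
    ∑ L ∈ wordsLE n N with p L, coeff N (X ^ L.length * seqWeight deltaP L) =
    ∑ L ∈ wordsLE n N with p L, coeff N (X ^ L.length *
        (seqWeight deltaTop (L.map Prod.fst) * seqWeight deltaBottom (L.map Prod.snd))) := by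
  have hmaps : ∀ L ∈ {L ∈ wordsLE n N | p L}, rker L ∈ {L ∈ wordsLE n N | p L}.image rker :=
    fun L hL => mem_image_of_mem _ hL
  rw [← sum_fiberwise_of_maps_to hmaps, ← sum_fiberwise_of_maps_to hmaps]
  refine sum_congr rfl fun T hT => ?_
  obtain ⟨K, hK, rfl⟩ := mem_image.1 hT
  have hpK := (hp K).1 (mem_filter.1 hK).2
  -- By `hp`, p holds on all words of a kernel or on none.
  have : {L ∈ {L ∈ wordsLE n N | p L} | rker L = rker K} =
      {L ∈ wordsLE n N | rker L = rker K} := by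
    rw [filter_filter]
    refine filter_congr fun L _ => ⟨fun h => h.2, fun h => ⟨(hp L).2 (h ▸ hpK), h⟩⟩
  rw [this, kernel_count (rreduced_rker K)]

theorem ker_eq_iff {C S : List (Colour n)} :
    reduce C = S ↔ rker C.reverse = S.reverse := by
  have := reduce_reverse C.reverse
  rw [List.reverse_reverse] at this
  rw [this, List.reverse_eq_iff]

open Classical in
theorem boundPrimcCount_eq (m : ℕ) (u v : Fin n → ℕ) :
    boundPrimcCount n m u v = boundFrobeniusCount n m u v := by
  let p : List (Colour n) → Prop := fun L =>
    (∀ i, boundCountA L.reverse i = u i) ∧ ∀ i, boundCountB L.reverse i = v i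
  have hp : ∀ L, p L ↔ p (rker L) := by
    intro L
    simp only [p, ← reduce_reverse, ← (boundCount_reduce L.reverse _).1,
      ← (boundCount_reduce L.reverse _).2]
  have h1 := (Primc_count p m).2
  have h2 := (Frobenius_count p m).2
  rw [sum_coeff_eq_of_kernel p hp, ← h2] at h1
  have h3 := Int.ofNat_inj.1 h1
  simp only [p, List.reverse_reverse] at h3
  rw [boundPrimcCount, boundFrobeniusCount]
  convert h3 using 2
  · ext l; simp only [Set.mem_ofPred_eq]; tauto
  · ext F; simp only [Set.mem_ofPred_eq]; tauto

theorem weightSeries_kernel_eq (S : List (Colour n)) :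
    weightSeries {l | l ∈ PrimcPartitions n ∧ l.ker = S} ColouredPartition.weight =
      weightSeries {F : FrobeniusPartition n | F.ker = S} FrobeniusPartition.weight := by
  ext m
  rw [weightSeries, weightSeries, coeff_mk, coeff_mk]
  have h1 := (Primc_count (n := n) (fun L => rker L = S.reverse) m).2
  have h2 := (Frobenius_count (n := n) (fun L => rker L = S.reverse) m).2
  -- Idempotence of reduction makes this condition depend only on the kernel.
  have hp : ∀ L : List (Colour n), rker L = S.reverse ↔ rker (rker L) = S.reverse := by
    intro L
    have h := reduce_eq_of_removals (removals_rker L)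
    rw [reduce_reverse (rker L), reduce_reverse, List.reverse_inj] at h
    rw [← h]
  rw [sum_coeff_eq_of_kernel _ hp, ← h2] at h1
  simp only [← ker_eq_iff] at h1
  convert h1 using 3
  · ext l; simp only [Set.mem_ofPred_eq, ColouredPartition.ker]; tauto
  · ext F; simp only [Set.mem_ofPred_eq, FrobeniusPartition.ker]

end Primc

theorem mainTheorem1 (n : ℕ) (hn : 0 < n) :
    -- there are finitely many objects of each weight, so that counts and series make sense
    (∀ m : ℕ, {l | l ∈ Primc.PrimcPartitions n ∧ l.weight = m}.Finite ∧
      {F : Primc.FrobeniusPartition n | F.weight = m}.Finite) ∧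
    -- equality of the counts with given numbers of symbols in bound colours
    (∀ (m : ℕ) (u v : Fin n → ℕ),
      Primc.boundPrimcCount n m u v = Primc.boundFrobeniusCount n m u v) ∧
    -- refinement: equality of the generating functions for each kernel
    (∀ S : List (Primc.Colour n), Primc.IsReduced S →
      Primc.weightSeries {l | l ∈ Primc.PrimcPartitions n ∧ l.ker = S}
          Primc.ColouredPartition.weight =
        Primc.weightSeries {F : Primc.FrobeniusPartition n | F.ker = S}
          Primc.FrobeniusPartition.weight) := by
  exact ⟨fun m => ⟨by simpa using (Primc.Primc_count (n := n) (fun _ => True) m).1,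
    by simpa using (Primc.Frobenius_count (n := n) (fun _ => True) m).1⟩,
    Primc.boundPrimcCount_eq, fun S _ => Primc.weightSeries_kernel_eq S⟩
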